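/- **Setting.** Let $\alpha\in(1,2]$, let $\mathbb R^{m\times n}$ carry the Frobenius inner product and norm, and put $d_0=\min\{m,n\}$. Let $f:\mathbb R^{m\times n}\to\mathbb R$ be bounded below by $f_\star\in\mathbb R$ and $L$-smooth, i.e. differentiable with $\|\nabla f(X)-\nabla f(Y)\|_F\le L\|X-Y\|_F$ for all $X,Y$ ($L\ge 0$). Fix deterministic $X_0, C_{-1}\in\mathbb R^{m\times n}$ (usually $C_{-1}=0$). Muon with Nesterov momentum and exact polar decomposition, with step size $\eta$, momentum parameter $\beta$ and batch size $B$, is, for $0\le k<K$, $$G_k=\frac1B\sum_{i=1}^B G_k^i,\quad C_k=\beta C_{k-1}+G_k,\quad M_k=\beta C_k+G_k,\quad X_{k+1}=X_k-\eta\,U_kV_k^\top,$$ where $M_k=U_k\Sigma_kV_k^\top$ is a singular value decomposition ($U_k,V_k$ with orthonormal columns, $\Sigma_k$ diagonal and nonnegative). Let $(\mathcal F_k)$ be a filtration containing all randomness up to the beginning of iteration $k$ ($X_k$ is $\mathcal F_k$-measurable, $G_k^i$ is $\mathcal F_{k+1}$-measurable). Assume generalized heavy-tailed noise with $\sigma_0,\sigma_1\ge0$: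 for all $k<K$, conditionally on $\mathcal F_k$ the $G_k^1,\dots,G_k^B$ are independent, $\mathbb E[G_k^i\mid\mathcal F_k]=\nabla f(X_k)$, and $$\mathbb E\big[\|G_k^i-\nabla f(X_k)\|_F^\alpha\mid\mathcal F_k\big]\le\sigma_0^\alpha+\sigma_1^\alpha\|\nabla f(X_k)\|_F^\alpha .$$ Put $S_0=(1-\beta)M_0-\nabla f(X_0)$. **Theorem.** There is a constant $\mathcal C_\alpha\in(0,2]$ depending only on $\alpha$ such that the following holds whenever $$B>\big(2\sqrt\pi\,(1+\sqrt{d_0})\,\mathcal C_\alpha^{1/\alpha}\sigma_1\big)^{\alpha/(\alpha-1)} .$$ Let $\rho_{\rm ex}=1-(1+\sqrt{d_0})\,2\sqrt\pi\,\mathcal C_\alpha^{1/\alpha}\sigma_1/B^{(\alpha-1)/\alpha}$. Then $\rho_{\rm ex}>0$, and for every horizon $K\ge2$, with $\eta=K^{-(2\alpha-1)/(3\alpha-2)}$ and $\beta=1-K^{-\alpha/(3\alpha-2)}$, $$\min_{0\le k\le K-1}\mathbb E\|\nabla f(X_k)\|_F\le c\,\Big(\frac{f(X_0)-f_\star}{\rho_{\rm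 ex}K^{\frac{\alpha-1}{3\alpha-2}}}+\frac{L}{\rho_{\rm ex}K^{\frac{\alpha-1}{3\alpha-2}}}+\frac{\sigma_0}{\rho_{\rm ex}B^{\frac{\alpha-1}{\alpha}}K^{\frac{\alpha-1}{3\alpha-2}}}+\frac{L}{\rho_{\rm ex}K^{\frac{2\alpha-1}{3\alpha-2}}}+\frac{\mathbb E\|S_0\|_F}{\rho_{\rm ex}K^{\frac{2\alpha-2}{3\alpha-2}}}+\frac{\sigma_1\|\nabla f(X_0)\|_F}{\rho_{\rm ex}B^{\frac{\alpha-1}{\alpha}}K}\Big)$$ with a constant $c$ depending only on $\alpha$ and $d_0$; all the expectations are finite. Consequently, for fixed problem parameters and fixed $B$ there is a constant $Q$, depending only on $\alpha,d_0,B,L,\sigma_0,\sigma_1$ and upper bounds on $f(X_0)-f_\star$, $\|\nabla f(X_0)\|_F$ and $\|C_{-1}\|_F$, such that $\min_{0\le k\le K-1}\mathbb E\|\nabla f(X_k)\|_F\le Q\,K^{-(\alpha-1)/(3\alpha-2)}$ for all $K\ge2$; and for every $\varepsilon\in(0,1]$ there is a horizon $K\ge 2$ with $K\le Q\,\varepsilon^{-(3\alpha-2)/(\alpha-1)}$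 (iterations) and $BK\le Q\,\varepsilon^{-(3\alpha-2)/(\alpha-1)}$ (stochastic gradient samples) for which $\min_{0\le k\le K-1}\mathbb E\|\nabla f(X_k)\|_F\le\varepsilon$. -/

import Mathlib

open MeasureTheory ProbabilityTheory
open scoped Gradient

universe u

noncomputable section

/-- The space `ℝ^{m×n}` of real matrices with the Frobenius inner product
`⟪X, Y⟫ = ∑ i j, X (i, j) * Y (i, j)`; its norm is the Frobenius norm, and `∇ f` is the usual
matrix gradient. -/
abbrev Mat (m n : ℕ) : Type := EuclideanSpace ℝ (Fin m × Fin n)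

/-- The element of `Mat m n` viewed as a matrix (for products and transposes). -/
def Mat.toMatrix {m n : ℕ} (X : Mat m n) : Matrix (Fin m) (Fin n) ℝ :=
  Matrix.of fun i j => X (i, j)

/-- `O` is an exact polar factor of `M`: `O = U Vᵀ` for some singular value decomposition
`M = U Σ Vᵀ`, where `U`, `V` have orthonormal columns and `Σ` is diagonal with nonnegative entries.
Compact (`r = rank M`) and thin (`r = min m n`) decompositions are both allowed. -/
def IsPolarFactor {m n : ℕ} (M O : Mat m n) : Prop :=
  ∃ (r : ℕ) (U : Matrix (Fin m) (Fin r) ℝ) (V : Matrix (Fin n) (Fin r) ℝ) (s : Fin r → ℝ),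
    U.transpose * U = 1 ∧ V.transpose * V = 1 ∧ (∀ i, 0 ≤ s i) ∧
      M.toMatrix = U * Matrix.diagonal s * V.transpose ∧
      O.toMatrix = U * V.transpose

/-- `f` is `L`-smooth: differentiable, with `L`-Lipschitz gradient in the Frobenius norm. -/
def LSmooth {m n : ℕ} (f : Mat m n → ℝ) (L : ℝ) : Prop :=
  Differentiable ℝ f ∧ ∀ X Y : Mat m n, ‖∇ f X - ∇ f Y‖ ≤ L * ‖X - Y‖

/-- The random elements `Y 1, …, Y B` are conditionally independent given the `σ`-algebra `m₀`:
`P(Y i ∈ A i for all i | m₀) = ∏ i, P(Y i ∈ A i | m₀)` almost surely, for all Borel sets `A i`.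
(Taking `A i = univ` gives the same for every subfamily. This is the formula characterizing
`ProbabilityTheory.iCondIndepFun`, which is only available on standard Borel spaces `Ω`.) -/
def CondIndepGiven {Ω E : Type*} [MeasurableSpace E] {B : ℕ}
    (m₀ : MeasurableSpace Ω) {mΩ : MeasurableSpace Ω} (μ : Measure Ω) (Y : Fin B → Ω → E) : Prop :=
  ∀ A : Fin B → Set E, (∀ i, MeasurableSet (A i)) →
    μ⟦⋂ i, Y i ⁻¹' A i | m₀⟧ =ᵐ[μ] ∏ i, μ⟦Y i ⁻¹' A i | m₀⟧

/-- The mini-batch gradient `G_k = (1/B) ∑ i, G_k^i`. -/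
def batchGrad {m n B : ℕ} {Ω : Type*} (G : ℕ → Fin B → Ω → Mat m n) (k : ℕ) (ω : Ω) : Mat m n :=
  (B : ℝ)⁻¹ • ∑ i, G k i ω

/-- `K` iterations of Muon with Nesterov momentum and exact polar decomposition, started from the
iterate `X₀` and the momentum `C_{-1} = Cinit`:
`C_k = β C_{k-1} + G_k`, `M_k = β C_k + G_k`, `X_{k+1} = X_k - η U_k V_kᵀ`, for `0 ≤ k < K`. -/
structure IsMuonRun {m n B : ℕ} {Ω : Type*} (K : ℕ) (η β : ℝ) (X₀ Cinit : Mat m n)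
    (G : ℕ → Fin B → Ω → Mat m n) (C M X : ℕ → Ω → Mat m n) : Prop where
  X_zero : ∀ ω, X 0 ω = X₀
  C_zero : ∀ ω, C 0 ω = β • Cinit + batchGrad G 0 ω
  C_succ : ∀ k, k + 1 < K → ∀ ω, C (k + 1) ω = β • C k ω + batchGrad G (k + 1) ω
  M_eq : ∀ k < K, ∀ ω, M k ω = β • C k ω + batchGrad G k ω
  X_succ : ∀ k < K, ∀ ω, ∃ O, IsPolarFactor (M k ω) O ∧ X (k + 1) ω = X k ω - η • O

/-- The generalized heavy-tailed noise assumption along the iterates `X 0, …, X (K - 1)`, where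
`𝓕 k` contains all randomness up to the beginning of iteration `k`. -/
structure HeavyTailedNoise {m n B : ℕ} {Ω : Type*} {mΩ : MeasurableSpace Ω} (μ : Measure Ω)
    (𝓕 : Filtration ℕ mΩ) (f : Mat m n → ℝ) (α σ₀ σ₁ : ℝ) (K : ℕ)
    (G : ℕ → Fin B → Ω → Mat m n) (X : ℕ → Ω → Mat m n) : Prop where
  adapted_X : ∀ k < K, StronglyMeasurable[𝓕 k] (X k)
  adapted_G : ∀ k < K, ∀ i, StronglyMeasurable[𝓕 (k + 1)] (G k i)
  condIndep : ∀ k < K, CondIndepGiven (𝓕 k) μ (G k)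
  integrable : ∀ k < K, ∀ i, Integrable (G k i) μ
  unbiased : ∀ k < K, ∀ i, μ[G k i | 𝓕 k] =ᵐ[μ] fun ω => ∇ f (X k ω)
  integrable_moment : ∀ k < K, ∀ i, Integrable (fun ω => ‖G k i ω - ∇ f (X k ω)‖ ^ α) μ
  moment_le : ∀ k < K, ∀ i,
    μ[fun ω => ‖G k i ω - ∇ f (X k ω)‖ ^ α | 𝓕 k] ≤ᵐ[μ]
      fun ω => σ₀ ^ α + σ₁ ^ α * ‖∇ f (X k ω)‖ ^ α

/-- The step size `η = K^{-(2α-1)/(3α-2)}`. -/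
def stepSize (α : ℝ) (K : ℕ) : ℝ := 1 / (K : ℝ) ^ ((2 * α - 1) / (3 * α - 2))

/-- The momentum parameter `β = 1 - K^{-α/(3α-2)}`. -/
def momentum (α : ℝ) (K : ℕ) : ℝ := 1 - 1 / (K : ℝ) ^ (α / (3 * α - 2))

/-- The batch-size threshold `(2 √π (1 + √d₀) C_α^{1/α} σ₁)^{α/(α-1)}`. -/
def batchThreshold (α Cα : ℝ) (d₀ : ℕ) (σ₁ : ℝ) : ℝ :=
  (2 * √Real.pi * (1 + √(d₀ : ℝ)) * Cα ^ (1 / α) * σ₁) ^ (α / (α - 1))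

/-- `ρ_ex = 1 - (1 + √d₀) 2 √π C_α^{1/α} σ₁ / B^{(α-1)/α}`. -/
def rhoEx (α Cα : ℝ) (d₀ : ℕ) (σ₁ : ℝ) (B : ℕ) : ℝ :=
  1 - (1 + √(d₀ : ℝ)) * (2 * √Real.pi) * Cα ^ (1 / α) * σ₁ / (B : ℝ) ^ ((α - 1) / α)

end

/-!
The proof takes `C_α = 2`. Write `g k = ‖∇ f (X k)‖` and `S k = (1 - β) M k - ∇ f (X k)`.

*Descent.* Since `M k` and `(1 - β) M k` have the same polar factor `O`, with `⟪M k, O⟫ ≥ ‖M k‖` and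
`‖O‖ ≤ √d₀`, smoothness gives `η g k ≤ f (X k) - f (X (k + 1)) + η (1 + √d₀) ‖S k‖ + L η² d₀`. This
is summed pathwise (`IsMuonRun.sum_norm_gradient_le`) and integrated afterwards, so that neither
integrability of `f (X k)` nor measurability of the last iterate is needed.

*Momentum error.* `S k` unrolls into `β ^ k S 0`, a discounted sum of differences of consecutive
gradients, each of norm at most `L η √d₀`, and discounted sums of the mini-batch noise `N j`
(`IsMuonRun.momentum_error_eq`).

*Noise.* Clarkson's inequality and conditional Jensen give the von Bahr–Esseen inequality
`𝔼 ‖∑ ξ i‖ ^ α ≤ 2 ∑ 𝔼 ‖ξ i‖ ^ α` for martingale differences in a Hilbert space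
(`integral_norm_sum_rpow_le`). Conditionally independent samples are martingale differences when
they are revealed one at a time (`CondIndepGiven.condExp_revealFiltration`), so the inequality
yields `𝔼[‖N k‖ ^ α | 𝓕 k] ≤ (c (σ₀ + σ₁ g k)) ^ α` with `c = (2 B ^ (1 - α)) ^ (1 / α)`.
A second application along the run must not produce `𝔼 (g k) ^ α`, which the descent inequality does
not control. Therefore `N k` is split by the predictable weight `σ₀ / (σ₀ + σ₁ g k)`: the first part
has conditional `α`-th moments at most `(c σ₀) ^ α` and gains a power of `1 - β` from von
Bahr–Esseen, the second has conditional first moments at most `c σ₁ g k`, and the triangle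
inequality keeps it linear in `𝔼 g k` (`PredictableNoise.integral_norm_discountedSum_le`).

*Rate.* The gradient-dependent noise enters the sum of the `𝔼 g k` with the coefficient
`3 (1 + √d₀) c σ₁`, and `3 ≤ 2 √π`, so it is absorbed at the price of the factor `ρ_ex`. The schedule
balances the remaining terms (`rate_of_sum_le`).
-/

/-! ### Polar factors -/

lemma Mat.inner_eq_trace {m n : ℕ} (X Y : Mat m n) :
    inner ℝ X Y = (X.toMatrix.transpose * Y.toMatrix).trace := by
  rw [PiLp.inner_apply, Fintype.sum_prod_type]
  simp only [Matrix.trace, Matrix.diag, Matrix.mul_apply, Matrix.transpose_apply, Mat.toMatrix,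
    Matrix.of_apply]
  rw [Finset.sum_comm]
  simp [mul_comm]

lemma Mat.norm_sq_eq_trace {m n : ℕ} (X : Mat m n) :
    ‖X‖ ^ 2 = (X.toMatrix.transpose * X.toMatrix).trace := by
  rw [← Mat.inner_eq_trace, real_inner_self_eq_norm_sq]

lemma Matrix.card_le_of_transpose_mul_self_eq_one {m r : ℕ} {U : Matrix (Fin m) (Fin r) ℝ}
    (hU : U.transpose * U = 1) : r ≤ m := by
  have h := Matrix.rank_mul_le_right U.transpose U
  rw [hU, Matrix.rank_one, Fintype.card_fin] at h
  exact h.trans (by simpa using U.rank_le_height)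

lemma IsPolarFactor.norm_le {m n : ℕ} {M O : Mat m n} (h : IsPolarFactor M O) :
    ‖O‖ ≤ √((min m n : ℕ) : ℝ) := by
  obtain ⟨r, U, V, s, hU, hV, -, -, hO⟩ := h
  apply Real.le_sqrt_of_sq_le
  rw [Mat.norm_sq_eq_trace, hO, Matrix.transpose_mul, Matrix.transpose_transpose, Matrix.mul_assoc,
    ← Matrix.mul_assoc U.transpose, hU, Matrix.one_mul, Matrix.trace_mul_comm, hV]
  simpa using ⟨Matrix.card_le_of_transpose_mul_self_eq_one hU,
    Matrix.card_le_of_transpose_mul_self_eq_one hV⟩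

/-- The inner product of a matrix with its polar factor is its nuclear norm, which dominates the
Frobenius norm. -/
lemma IsPolarFactor.norm_le_inner {m n : ℕ} {M O : Mat m n} (h : IsPolarFactor M O) :
    ‖M‖ ≤ inner ℝ M O := by
  obtain ⟨r, U, V, s, hU, hV, hs, hM, hO⟩ := h
  have h1 : inner ℝ M O = ∑ i, s i := by
    rw [Mat.inner_eq_trace, hO, hM, Matrix.transpose_mul, Matrix.transpose_mul,
      Matrix.transpose_transpose, Matrix.diagonal_transpose, Matrix.mul_assoc, Matrix.mul_assoc,
      ← Matrix.mul_assoc U.transpose, hU, Matrix.one_mul, Matrix.trace_mul_comm, Matrix.mul_assoc,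
      hV, Matrix.mul_one, Matrix.trace_diagonal]
  have h2 : ‖M‖ ^ 2 = ∑ i, s i ^ 2 := by
    rw [Mat.norm_sq_eq_trace, hM, Matrix.transpose_mul, Matrix.transpose_mul,
      Matrix.transpose_transpose, Matrix.diagonal_transpose, Matrix.mul_assoc, Matrix.mul_assoc,
      Matrix.mul_assoc, ← Matrix.mul_assoc U.transpose, hU, Matrix.one_mul, Matrix.trace_mul_comm,
      Matrix.mul_assoc, Matrix.mul_assoc, hV, Matrix.mul_one, Matrix.diagonal_mul_diagonal,
      Matrix.trace_diagonal]
    simp [sq]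
  rw [h1]
  refine le_of_sq_le_sq ?_ (Finset.sum_nonneg fun i _ => hs i)
  rw [h2]
  exact Finset.sum_sq_le_sq_sum_of_nonneg fun i _ => hs i

/-! ### Descent along a run -/

lemma LSmooth.continuous_gradient {m n : ℕ} {f : Mat m n → ℝ} {L : ℝ} (hf : LSmooth f L)
    (hL : 0 ≤ L) : Continuous (∇ f) :=
  (LipschitzWith.of_dist_le_mul (K := ⟨L, hL⟩) fun X Y => by
    rw [dist_eq_norm, dist_eq_norm]; exact hf.2 X Y).continuous

/-- The first-order upper model of an `L`-smooth function. The mean value inequality gives the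
constant `L` in place of the optimal `L / 2`. -/
lemma LSmooth.le_add_inner_add {m n : ℕ} {f : Mat m n → ℝ} {L : ℝ} (hf : LSmooth f L) (hL : 0 ≤ L)
    (X D : Mat m n) : f (X + D) ≤ f X + inner ℝ (∇ f X) D + L * ‖D‖ ^ 2 := by
  have hd : ∀ Y ∈ segment ℝ X (X + D),
      HasFDerivWithinAt f (InnerProductSpace.toDual ℝ _ (∇ f Y)) (segment ℝ X (X + D)) Y :=
    fun Y _ => (hf.1 Y).hasGradientAt.hasFDerivAt.hasFDerivWithinAt
  have hb : ∀ Y ∈ segment ℝ X (X + D), ‖InnerProductSpace.toDual ℝ _ (∇ f Y) -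
      InnerProductSpace.toDual ℝ _ (∇ f X)‖ ≤ L * ‖D‖ := by
    intro Y hY
    rw [← map_sub, LinearIsometryEquiv.norm_map]
    refine (hf.2 Y X).trans (mul_le_mul_of_nonneg_left ?_ hL)
    simpa using norm_sub_le_of_mem_segment hY
  have h := (convex_segment X (X + D)).norm_image_sub_le_of_norm_hasFDerivWithin_le' hd hb
    (left_mem_segment ℝ X (X + D)) (right_mem_segment ℝ X (X + D))
  rw [add_sub_cancel_left, InnerProductSpace.toDual_apply_apply, Real.norm_eq_abs] at h
  have := (abs_le.1 h).2
  nlinarith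

namespace IsMuonRun

variable {m n B : ℕ} {Ω : Type*} {K : ℕ} {η β : ℝ} {X₀ Cinit : Mat m n}
  {G : ℕ → Fin B → Ω → Mat m n} {C M X : ℕ → Ω → Mat m n}

lemma norm_step_le (h : IsMuonRun K η β X₀ Cinit G C M X) (hη : 0 ≤ η) {k : ℕ} (hk : k < K)
    (ω : Ω) : ‖X (k + 1) ω - X k ω‖ ≤ η * √((min m n : ℕ) : ℝ) := by
  obtain ⟨O, hO, hX⟩ := h.X_succ k hk ω
  rw [hX, sub_sub_cancel_left, norm_neg, norm_smul, Real.norm_of_nonneg hη]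
  exact mul_le_mul_of_nonneg_left hO.norm_le hη

lemma norm_sub_init_le (h : IsMuonRun K η β X₀ Cinit G C M X) (hη : 0 ≤ η) {k : ℕ} (hk : k ≤ K)
    (ω : Ω) : ‖X k ω - X₀‖ ≤ k * (η * √((min m n : ℕ) : ℝ)) := by
  induction k with
  | zero => simp [h.X_zero]
  | succ k ih =>
    have h1 := ih (by omega)
    have h2 := h.norm_step_le hη (k := k) (by omega) ω
    have h3 := norm_add_le (X (k + 1) ω - X k ω) (X k ω - X₀)
    rw [sub_add_sub_cancel] at h3
    rw [Nat.cast_succ]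
    linarith

/-- Along a run the gradients are bounded by a deterministic constant, because every step has
bounded length. -/
lemma norm_gradient_le (h : IsMuonRun K η β X₀ Cinit G C M X) (hη : 0 ≤ η) {f : Mat m n → ℝ}
    {L : ℝ} (hf : LSmooth f L) (hL : 0 ≤ L) {k : ℕ} (hk : k < K) (ω : Ω) :
    ‖∇ f (X k ω)‖ ≤ ‖∇ f X₀‖ + L * (K * (η * √((min m n : ℕ) : ℝ))) := by
  have h1 := norm_add_le (∇ f (X k ω) - ∇ f X₀) (∇ f X₀)
  rw [sub_add_cancel] at h1
  have h2 : ‖X k ω - X₀‖ ≤ K * (η * √((min m n : ℕ) : ℝ)) :=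
    (h.norm_sub_init_le hη hk.le ω).trans (by gcongr)
  have h3 := mul_le_mul_of_nonneg_left h2 hL
  linarith [hf.2 (X k ω) X₀]

/-- One step decreases the objective by `η ‖∇ f‖`, up to the momentum error and a second-order
term. Rescaling `M` by `1 - β > 0` does not change its polar factor. -/
lemma descent_step (h : IsMuonRun K η β X₀ Cinit G C M X) (hη : 0 ≤ η) (hβ : β ≤ 1)
    {f : Mat m n → ℝ} {L : ℝ} (hf : LSmooth f L) (hL : 0 ≤ L) {k : ℕ} (hk : k < K) (ω : Ω) :
    f (X (k + 1) ω) + η * ‖∇ f (X k ω)‖ ≤ f (X k ω)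
      + η * ((1 + √((min m n : ℕ) : ℝ)) * ‖(1 - β) • M k ω - ∇ f (X k ω)‖)
      + L * η ^ 2 * (min m n : ℕ) := by
  obtain ⟨O, hO, hX⟩ := h.X_succ k hk ω
  set S := (1 - β) • M k ω - ∇ f (X k ω) with hS
  set d : ℝ := √((min m n : ℕ) : ℝ)
  have hd : d ^ 2 = ((min m n : ℕ) : ℝ) := Real.sq_sqrt (Nat.cast_nonneg _)
  have h1 := hf.le_add_inner_add hL (X k ω) (-(η • O))
  rw [← sub_eq_add_neg, ← hX, norm_neg, norm_smul, Real.norm_of_nonneg hη, inner_neg_right,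
    inner_smul_right] at h1
  have h2 : ∇ f (X k ω) = (1 - β) • M k ω - S := by rw [hS]; abel
  have h3 : (1 - β) * ‖M k ω‖ - ‖S‖ * d ≤ inner ℝ (∇ f (X k ω)) O := by
    rw [h2, inner_sub_left, real_inner_smul_left]
    have a := mul_le_mul_of_nonneg_left hO.norm_le_inner (sub_nonneg.2 hβ)
    have b := (real_inner_le_norm S O).trans
      (mul_le_mul_of_nonneg_left hO.norm_le (norm_nonneg S))
    linarith
  have h4 : ‖∇ f (X k ω)‖ ≤ (1 - β) * ‖M k ω‖ + ‖S‖ := by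
    conv_lhs => rw [h2]
    refine (norm_sub_le _ _).trans_eq ?_
    rw [norm_smul, Real.norm_of_nonneg (sub_nonneg.2 hβ)]
  have h5 : ‖O‖ ^ 2 ≤ d ^ 2 := pow_le_pow_left₀ (norm_nonneg _) hO.norm_le 2
  have h6 : L * (η * ‖O‖) ^ 2 ≤ L * η ^ 2 * d ^ 2 := by
    rw [mul_pow, ← mul_assoc]; gcongr
  have h7 : ‖∇ f (X k ω)‖ - ‖S‖ - ‖S‖ * d ≤ inner ℝ (∇ f (X k ω)) O := by linarith
  have h8 := mul_le_mul_of_nonneg_left h7 hη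
  rw [hd] at h6
  nlinarith

lemma sum_norm_gradient_le (h : IsMuonRun K η β X₀ Cinit G C M X) (hη : 0 ≤ η) (hβ : β ≤ 1)
    {f : Mat m n → ℝ} {L fstar : ℝ} (hf : LSmooth f L) (hL : 0 ≤ L) (hb : ∀ Y, fstar ≤ f Y)
    (ω : Ω) :
    η * ∑ k ∈ Finset.range K, ‖∇ f (X k ω)‖ ≤ f X₀ - fstar
      + η * ((1 + √((min m n : ℕ) : ℝ)) *
        ∑ k ∈ Finset.range K, ‖(1 - β) • M k ω - ∇ f (X k ω)‖)
      + K * (L * η ^ 2 * (min m n : ℕ)) := by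
  have key : ∀ j ≤ K, f (X j ω) + η * ∑ k ∈ Finset.range j, ‖∇ f (X k ω)‖ ≤ f X₀
      + η * ((1 + √((min m n : ℕ) : ℝ)) *
        ∑ k ∈ Finset.range j, ‖(1 - β) • M k ω - ∇ f (X k ω)‖)
      + j * (L * η ^ 2 * (min m n : ℕ)) := by
    intro j hj
    induction j with
    | zero => simp [h.X_zero]
    | succ j ih =>
      have h1 := ih (by omega)
      have h2 := h.descent_step hη hβ hf hL (k := j) (by omega) ω
      rw [Finset.sum_range_succ, Finset.sum_range_succ]
      push_cast at h1 h2 ⊢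
      linarith
  linarith [key K le_rfl, hb (X K ω)]

end IsMuonRun

/-! ### The momentum error -/

/-- The discounted sum `∑ j < k, β ^ (k - 1 - j) • N j`; no subtraction truncates, as `j < k`. -/
def discountedSum {E : Type*} [AddCommGroup E] [Module ℝ E] (β : ℝ) (N : ℕ → E) (k : ℕ) : E :=
  ∑ j ∈ Finset.range k, β ^ (k - 1 - j) • N j

lemma discountedSum_zero {E : Type*} [AddCommGroup E] [Module ℝ E] (β : ℝ) (N : ℕ → E) :
    discountedSum β N 0 = 0 := by simp [discountedSum]

lemma discountedSum_succ {E : Type*} [AddCommGroup E] [Module ℝ E] (β : ℝ) (N : ℕ → E) (k : ℕ) :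
    discountedSum β N (k + 1) = β • discountedSum β N k + N k := by
  rw [discountedSum, discountedSum, Finset.sum_range_succ, Finset.smul_sum]
  congr 1
  · refine Finset.sum_congr rfl fun j hj => ?_
    rw [smul_smul, ← pow_succ']
    congr 2
    have := Finset.mem_range.1 hj
    omega
  · simp

/-- Nesterov's momentum error `(1 - β) M k - ∇ f (X k)` unrolls into the initial error, the
discounted drift of the gradients and discounted sums of the gradient noise. -/
lemma IsMuonRun.momentum_error_eq {m n B : ℕ} {Ω : Type*} {K : ℕ} {η β : ℝ} {X₀ Cinit : Mat m n}
    {G : ℕ → Fin B → Ω → Mat m n} {C M X : ℕ → Ω → Mat m n}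
    (h : IsMuonRun K η β X₀ Cinit G C M X) (f : Mat m n → ℝ) (ω : Ω) {k : ℕ} (hk : k < K) :
    (1 - β) • M k ω - ∇ f (X k ω) = β ^ k • ((1 - β) • M 0 ω - ∇ f (X 0 ω))
      + β ^ 2 • discountedSum β (fun j => ∇ f (X j ω) - ∇ f (X (j + 1) ω)) k
      + (1 - β) • ((1 + β) • discountedSum β (fun j => batchGrad G j ω - ∇ f (X j ω)) (k + 1)
        - β • discountedSum β (fun j => batchGrad G j ω - ∇ f (X j ω)) k
        - ((1 + β) * β ^ k) • (batchGrad G 0 ω - ∇ f (X 0 ω))) := by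
  induction k with
  | zero =>
    rw [discountedSum_succ, discountedSum_zero, discountedSum_zero]
    module
  | succ k ih =>
    have h0 := ih (by omega)
    rw [discountedSum_succ _ _ (k + 1), discountedSum_succ _ _ k, discountedSum_succ _ _ k]
    rw [discountedSum_succ _ _ k] at h0
    rw [h.M_eq (k + 1) hk, h.C_succ k hk]
    have h1 := h.M_eq k (by omega) ω
    have h2 : β • ((1 - β) • M k ω - ∇ f (X k ω)) = β • _ := congrArg (β • ·) h0
    have h3 : β • C k ω = M k ω - batchGrad G k ω := by rw [h1]; abel
    rw [h3]
    have h4 : (1 - β) • (β • (M k ω - batchGrad G k ω + batchGrad G (k + 1) ω)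
        + batchGrad G (k + 1) ω) - ∇ f (X (k + 1) ω)
        = β • ((1 - β) • M k ω - ∇ f (X k ω)) + (β • ∇ f (X k ω) - ∇ f (X (k + 1) ω)
          + (1 - β) • ((1 + β) • batchGrad G (k + 1) ω - β • batchGrad G k ω)) := by module
    rw [h4, h2]
    module

/-! ### The von Bahr–Esseen inequality in Hilbert spaces -/

/-- Clarkson's inequality for exponents at most two: the parallelogram law combined with concavity
of `t ↦ t ^ (p / 2)`. -/
lemma norm_add_rpow_add_norm_sub_rpow_le {E : Type*} [NormedAddCommGroup E]
    [InnerProductSpace ℝ E] {p : ℝ} (hp0 : 0 < p) (hp2 : p ≤ 2) (x y : E) :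
    ‖x + y‖ ^ p + ‖x - y‖ ^ p ≤ 2 * (‖x‖ ^ p + ‖y‖ ^ p) := by
  have hsq : ∀ z : E, ‖z‖ ^ p = (‖z‖ ^ 2) ^ (p / 2) := fun z => by
    rw [← Real.rpow_natCast, ← Real.rpow_mul (norm_nonneg z)]
    congr 1; push_cast; ring
  have hq0 : 0 ≤ p / 2 := by positivity
  have hq1 : p / 2 ≤ 1 := by linarith
  have h1 := (Real.concaveOn_rpow hq0 hq1).2 (Set.mem_Ici.2 (sq_nonneg ‖x + y‖))
    (Set.mem_Ici.2 (sq_nonneg ‖x - y‖)) (show (0 : ℝ) ≤ 1 / 2 by norm_num)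
    (show (0 : ℝ) ≤ 1 / 2 by norm_num) (by norm_num)
  have h2 : (1 / 2 : ℝ) • ‖x + y‖ ^ 2 + (1 / 2 : ℝ) • ‖x - y‖ ^ 2 = ‖x‖ ^ 2 + ‖y‖ ^ 2 := by
    have := parallelogram_law_with_norm ℝ x y
    simp only [smul_eq_mul]
    nlinarith
  rw [h2] at h1
  have h3 := Real.rpow_add_le_add_rpow (sq_nonneg ‖x‖) (sq_nonneg ‖y‖) hq0 hq1
  rw [hsq, hsq, hsq x, hsq y]
  simp only [smul_eq_mul] at h1
  linarith

lemma MeasureTheory.MemLp.integrable_norm_rpow_ofReal {Ω E : Type*} {mΩ : MeasurableSpace Ω}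
    {μ : Measure Ω} [NormedAddCommGroup E] {p : ℝ} (hp : 0 < p) {x : Ω → E}
    (hx : MemLp x (ENNReal.ofReal p) μ) : Integrable (fun ω => ‖x ω‖ ^ p) μ := by
  have := hx.integrable_norm_rpow (by simpa using hp) ENNReal.ofReal_ne_top
  rwa [ENNReal.toReal_ofReal hp.le] at this

lemma MeasureTheory.AEStronglyMeasurable.memLp_of_integrable_norm_rpow {Ω E : Type*}
    {mΩ : MeasurableSpace Ω} {μ : Measure Ω} [NormedAddCommGroup E] {p : ℝ} (hp : 0 < p)
    {x : Ω → E} (hx : AEStronglyMeasurable x μ) (hi : Integrable (fun ω => ‖x ω‖ ^ p) μ) :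
    MemLp x (ENNReal.ofReal p) μ := by
  rw [← integrable_norm_rpow_iff hx (by simpa using hp) ENNReal.ofReal_ne_top,
    ENNReal.toReal_ofReal hp.le]
  exact hi

section VonBahrEsseen

variable {Ω E : Type*} {mΩ : MeasurableSpace Ω} {μ : Measure Ω} [IsProbabilityMeasure μ]
  [NormedAddCommGroup E] [InnerProductSpace ℝ E] [CompleteSpace E]

/-- Adding a conditionally centered increment raises the `p`-th moment by at most twice the `p`-th
moment of the increment: conditional Jensen for `x - y` turns the second term of Clarkson's
inequality into a lower bound by `𝔼 ‖x‖ ^ p`. -/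
lemma integral_norm_add_rpow_le {p : ℝ} (hp1 : 1 ≤ p) (hp2 : p ≤ 2) {m₀ : MeasurableSpace Ω}
    (hm : m₀ ≤ mΩ) {x y : Ω → E} (hx : StronglyMeasurable[m₀] x)
    (hxp : MemLp x (ENNReal.ofReal p) μ) (hyp : MemLp y (ENNReal.ofReal p) μ)
    (hy : μ[y | m₀] =ᵐ[μ] 0) :
    ∫ ω, ‖x ω + y ω‖ ^ p ∂μ ≤ ∫ ω, ‖x ω‖ ^ p ∂μ + 2 * ∫ ω, ‖y ω‖ ^ p ∂μ := by
  have hp0 : 0 < p := by linarith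
  have hone : 1 ≤ ENNReal.ofReal p := by simpa using hp1
  have ix := hxp.integrable_norm_rpow_ofReal hp0
  have iy := hyp.integrable_norm_rpow_ofReal hp0
  have ia := (hxp.add hyp).integrable_norm_rpow_ofReal hp0
  have is := (hxp.sub hyp).integrable_norm_rpow_ofReal hp0
  simp only [Pi.add_apply, Pi.sub_apply] at ia is
  have h1 : ∫ ω, ‖x ω + y ω‖ ^ p ∂μ + ∫ ω, ‖x ω - y ω‖ ^ p ∂μ
      ≤ 2 * (∫ ω, ‖x ω‖ ^ p ∂μ + ∫ ω, ‖y ω‖ ^ p ∂μ) := by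
    rw [← integral_add ia is, ← integral_add ix iy, ← integral_const_mul]
    exact integral_mono (ia.add is) ((ix.add iy).const_mul 2)
      fun ω => norm_add_rpow_add_norm_sub_rpow_le hp0 hp2 _ _
  have h2 : ∫ ω, ‖x ω‖ ^ p ∂μ ≤ ∫ ω, ‖x ω - y ω‖ ^ p ∂μ := by
    have hc : μ[x - y | m₀] =ᵐ[μ] x := by
      filter_upwards [condExp_sub (hxp.integrable hone) (hyp.integrable hone) m₀, hy] with ω h h'
      rw [h, Pi.sub_apply, h', condExp_of_stronglyMeasurable hm hx (hxp.integrable hone)]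
      simp
    have hj := Integrable.norm_condExp_rpow_le (m := m₀) (f := x - y) hp1
      (by simpa only [Pi.sub_apply] using is)
    rw [← integral_condExp hm (f := fun ω => ‖x ω - y ω‖ ^ p)]
    refine integral_mono_ae ix integrable_condExp ?_
    filter_upwards [hj, hc] with ω h h'
    simp only [h', Pi.sub_apply] at h
    exact h
  linarith

/-- The **von Bahr–Esseen inequality** for martingale differences in a Hilbert space. -/
theorem integral_norm_sum_rpow_le {p : ℝ} (hp1 : 1 ≤ p) (hp2 : p ≤ 2) (𝓖 : Filtration ℕ mΩ)
    (ξ : ℕ → Ω → E) (n : ℕ) (hmeas : ∀ i < n, StronglyMeasurable[𝓖 (i + 1)] (ξ i))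
    (hLp : ∀ i < n, MemLp (ξ i) (ENNReal.ofReal p) μ) (h0 : ∀ i < n, μ[ξ i | 𝓖 i] =ᵐ[μ] 0) :
    ∫ ω, ‖∑ i ∈ Finset.range n, ξ i ω‖ ^ p ∂μ
      ≤ 2 * ∑ i ∈ Finset.range n, ∫ ω, ‖ξ i ω‖ ^ p ∂μ := by
  induction n with
  | zero => simp [Real.zero_rpow (by linarith : p ≠ 0)]
  | succ n ih =>
    have h1 := ih (fun i hi => hmeas i (by omega)) (fun i hi => hLp i (by omega))
      (fun i hi => h0 i (by omega))
    have hx : StronglyMeasurable[𝓖 n] fun ω => ∑ i ∈ Finset.range n, ξ i ω :=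
      Finset.stronglyMeasurable_fun_sum _ fun i hi =>
        (hmeas i (by have := Finset.mem_range.1 hi; omega)).mono
          (𝓖.mono (by have := Finset.mem_range.1 hi; omega))
    have hxp : MemLp (fun ω => ∑ i ∈ Finset.range n, ξ i ω) (ENNReal.ofReal p) μ :=
      memLp_finsetSum _ fun i hi => hLp i (by have := Finset.mem_range.1 hi; omega)
    have h2 := integral_norm_add_rpow_le hp1 hp2 (𝓖.le n) hx hxp (hLp n (by omega))
      (h0 n (by omega))
    simp only [Finset.sum_range_succ]
    linarith

end VonBahrEsseen

/-! ### Conditional independence -/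

section RevealFiltration

variable {Ω E : Type*} {m₀ mΩ : MeasurableSpace Ω} [MeasurableSpace E] {B : ℕ}

/-- The filtration which starts from `m₀` and reveals `Y 0, Y 1, …` one after the other. -/
def revealFiltration (hm : m₀ ≤ mΩ) (Y : Fin B → Ω → E) (hY : ∀ i, Measurable (Y i)) :
    Filtration ℕ mΩ where
  seq i := m₀ ⊔ ⨆ j : Fin B, ⨆ _ : (j : ℕ) < i, MeasurableSpace.comap (Y j) inferInstance
  mono' a b hab := by
    refine sup_le_sup_left (iSup_mono fun j => iSup_le fun h => ?_) m₀
    exact le_iSup (fun _ : (j : ℕ) < b => MeasurableSpace.comap (Y j) inferInstance)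
      (h.trans_le hab)
  le' i := by
    refine sup_le hm (iSup_le fun j => iSup_le fun _ => ?_)
    exact (hY j).comap_le

/-- The events which combine an event of `m₀` with Borel conditions on the `Y j`, `j < i`. -/
def revealRectangles (m₀ : MeasurableSpace Ω) (Y : Fin B → Ω → E) (i : ℕ) : Set (Set Ω) :=
  {S | ∃ A, MeasurableSet[m₀] A ∧ ∃ D : Fin B → Set E, (∀ j, MeasurableSet (D j)) ∧
    (∀ j : Fin B, i ≤ (j : ℕ) → D j = Set.univ) ∧ S = A ∩ ⋂ j, Y j ⁻¹' D j}

lemma isPiSystem_revealRectangles (Y : Fin B → Ω → E) (i : ℕ) :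
    IsPiSystem (revealRectangles m₀ Y i) := by
  rintro _ ⟨A, hA, D, hD, hDi, rfl⟩ _ ⟨A', hA', D', hD', hDi', rfl⟩ -
  refine ⟨A ∩ A', hA.inter hA', fun j => D j ∩ D' j, fun j => (hD j).inter (hD' j),
    fun j hj => by simp only [hDi j hj, hDi' j hj, Set.inter_univ], ?_⟩
  simp only [Set.preimage_inter, Set.iInter_inter_distrib]
  exact Set.inter_inter_inter_comm _ _ _ _

lemma revealFiltration_eq_generateFrom (hm : m₀ ≤ mΩ) (Y : Fin B → Ω → E)
    (hY : ∀ i, Measurable (Y i)) (i : ℕ) :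
    revealFiltration hm Y hY i = MeasurableSpace.generateFrom (revealRectangles m₀ Y i) := by
  classical
  apply le_antisymm
  · refine sup_le (fun A hA => ?_) (iSup_le fun j => iSup_le fun hj => ?_)
    · exact MeasurableSpace.measurableSet_generateFrom
        ⟨A, hA, fun _ => Set.univ, fun _ => .univ, fun _ _ => rfl, by simp⟩
    · rintro _ ⟨S, hS, rfl⟩
      refine MeasurableSpace.measurableSet_generateFrom
        ⟨Set.univ, .univ, Function.update (fun _ => Set.univ) j S, fun l => ?_, fun l hl => ?_, ?_⟩
      · by_cases h : l = j
        · subst h; simpa using hS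
        · simp [h]
      · have h : l ≠ j := by rintro rfl; omega
        simp [h]
      · ext ω
        simp only [Set.univ_inter, Set.mem_iInter, Set.mem_preimage]
        refine ⟨fun h l => ?_, fun h => by simpa using h j⟩
        by_cases hl : l = j
        · subst hl; simpa using h
        · simp [hl]
  · refine MeasurableSpace.generateFrom_le ?_
    rintro _ ⟨A, hA, D, hD, hDi, rfl⟩
    refine MeasurableSet.inter ((le_sup_left : m₀ ≤ revealFiltration hm Y hY i) _ hA)
      (MeasurableSet.iInter fun j => ?_)
    by_cases hj : (j : ℕ) < i
    · have h : MeasurableSpace.comap (Y j) inferInstance ≤ revealFiltration hm Y hY i :=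
        (le_iSup₂_of_le j hj le_rfl : _ ≤ ⨆ j : Fin B, ⨆ _ : (j : ℕ) < i,
          MeasurableSpace.comap (Y j) inferInstance).trans le_sup_right
      exact h _ ⟨D j, hD j, rfl⟩
    · rw [hDi j (by omega)]
      simp

lemma le_revealFiltration (hm : m₀ ≤ mΩ) (Y : Fin B → Ω → E) (hY : ∀ i, Measurable (Y i))
    (i : ℕ) : m₀ ≤ revealFiltration hm Y hY i := by
  change m₀ ≤ m₀ ⊔ _
  exact le_sup_left

lemma measurable_revealFiltration_succ (hm : m₀ ≤ mΩ) (Y : Fin B → Ω → E)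
    (hY : ∀ i, Measurable (Y i)) (i : Fin B) :
    Measurable[revealFiltration hm Y hY (i + 1)] (Y i) := by
  have h : MeasurableSpace.comap (Y i) inferInstance ≤ revealFiltration hm Y hY (i + 1) :=
    (le_iSup₂_of_le i (Nat.lt_succ_self _) le_rfl : _ ≤ ⨆ j : Fin B, ⨆ _ : (j : ℕ) < i + 1,
      MeasurableSpace.comap (Y j) inferInstance).trans le_sup_right
  exact fun s hs => h _ ⟨s, hs, rfl⟩

end RevealFiltration

/-- Conditional independence of the event `⋂ j, Y j ∈ D j`, which does not constrain `Y i`, from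
events of `Y i`, in integrated form. -/
lemma CondIndepGiven.setIntegral_condExp_indicator {Ω E : Type*}
    {m₀ mΩ : MeasurableSpace Ω} {μ : Measure Ω} [IsProbabilityMeasure μ] [MeasurableSpace E] {B : ℕ}
    {Y : Fin B → Ω → E} (hm : m₀ ≤ mΩ)
    (hY : ∀ i, Measurable (Y i)) (h : CondIndepGiven m₀ μ Y) {i : Fin B} {A : Set Ω}
    (hA : MeasurableSet[m₀] A) {D : Fin B → Set E} (hD : ∀ j, MeasurableSet (D j))
    (hDi : D i = Set.univ) {S : Set E} (hS : MeasurableSet S) :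
    μ.real (A ∩ (⋂ j, Y j ⁻¹' D j) ∩ Y i ⁻¹' S)
      = ∫ ω in A ∩ Y i ⁻¹' S, (μ⟦⋂ j, Y j ⁻¹' D j | m₀⟧) ω ∂μ := by
  classical
  set T := ⋂ j, Y j ⁻¹' D j with hT
  have hTm : MeasurableSet T := MeasurableSet.iInter fun j => hY j (hD j)
  have hSm : MeasurableSet (Y i ⁻¹' S) := hY i hS
  have hTS : T ∩ Y i ⁻¹' S = ⋂ j, Y j ⁻¹' (Function.update D i S) j := by
    ext ω
    simp only [hT, Set.mem_inter_iff, Set.mem_iInter, Set.mem_preimage]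
    constructor
    · rintro ⟨h1, h2⟩ j
      by_cases hj : j = i
      · subst hj; simpa using h2
      · simpa [hj] using h1 j
    · intro h1
      refine ⟨fun j => ?_, by simpa using h1 i⟩
      by_cases hj : j = i
      · subst hj; simp [hDi]
      · simpa [hj] using h1 j
  have hUm : ∀ j, MeasurableSet (Function.update D i S j) := fun j => by
    by_cases hj : j = i
    · subst hj; simpa using hS
    · simpa [hj] using hD j
  have hprod : μ⟦T ∩ Y i ⁻¹' S | m₀⟧ =ᵐ[μ] μ⟦T | m₀⟧ * μ⟦Y i ⁻¹' S | m₀⟧ := by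
    rw [hTS]
    have huniv : μ⟦Y i ⁻¹' D i | m₀⟧ = fun _ => (1 : ℝ) := by
      rw [hDi, Set.preimage_univ, Set.indicator_univ, condExp_const hm]
    filter_upwards [h _ hUm, h _ hD] with ω h1 h2
    rw [h1, Pi.mul_apply, h2, Finset.prod_apply, Finset.prod_apply,
      ← Finset.mul_prod_erase _ _ (Finset.mem_univ i),
      ← Finset.mul_prod_erase (a := i) _ (fun j => (μ⟦Y j ⁻¹' D j | m₀⟧) ω) (Finset.mem_univ i),
      huniv, one_mul, Function.update_self, mul_comm]
    congr 1
    refine Finset.prod_congr rfl fun j hj => ?_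
    rw [Function.update_of_ne (Finset.ne_of_mem_erase hj)]
  have hZb : ∀ᵐ ω ∂μ, ‖(μ⟦T | m₀⟧) ω‖ ≤ 1 := by
    have := ae_bdd_abs_condExp_of_ae_bdd_abs (m := m₀) (μ := μ) (R := (1 : ℝ)) (f := T.indicator fun _ => (1 : ℝ))
      (ae_of_all _ fun ω => by by_cases hω : ω ∈ T <;> simp [hω])
    simpa using this
  have hpull : μ[μ⟦T | m₀⟧ * (Y i ⁻¹' S).indicator (fun _ => (1 : ℝ)) | m₀]
      =ᵐ[μ] μ⟦T | m₀⟧ * μ⟦Y i ⁻¹' S | m₀⟧ :=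
    condExp_stronglyMeasurable_mul_of_bound hm stronglyMeasurable_condExp
      ((integrable_const _).indicator hSm) 1 hZb
  have hint : Integrable (μ⟦T | m₀⟧ * (Y i ⁻¹' S).indicator (fun _ => (1 : ℝ))) μ :=
    ((integrable_const (1 : ℝ)).indicator hSm).bdd_mul
      integrable_condExp.aestronglyMeasurable hZb
  calc μ.real (A ∩ T ∩ Y i ⁻¹' S)
      = ∫ ω in A, (T ∩ Y i ⁻¹' S).indicator (fun _ => (1 : ℝ)) ω ∂μ := by
        rw [integral_indicator_const _ (hTm.inter hSm),
          measureReal_restrict_apply (hTm.inter hSm), smul_eq_mul, mul_one, Set.inter_assoc,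
          Set.inter_comm]
    _ = ∫ ω in A, (μ⟦T ∩ Y i ⁻¹' S | m₀⟧) ω ∂μ :=
        (setIntegral_condExp hm ((integrable_const _).indicator (hTm.inter hSm)) hA).symm
    _ = ∫ ω in A, (μ[μ⟦T | m₀⟧ * (Y i ⁻¹' S).indicator (fun _ => (1 : ℝ)) | m₀]) ω ∂μ :=
        setIntegral_congr_ae (hm _ hA) (by
          filter_upwards [hprod, hpull] with ω h1 h2 _
          rw [h1, h2])
    _ = ∫ ω in A, (μ⟦T | m₀⟧ * (Y i ⁻¹' S).indicator (fun _ => (1 : ℝ))) ω ∂μ :=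
        setIntegral_condExp hm hint hA
    _ = ∫ ω in A, (Y i ⁻¹' S).indicator (μ⟦T | m₀⟧) ω ∂μ := by
        congr 1; ext ω
        by_cases hω : ω ∈ Y i ⁻¹' S <;> simp [hω]
    _ = ∫ ω in A ∩ Y i ⁻¹' S, (μ⟦T | m₀⟧) ω ∂μ := setIntegral_indicator hSm

section CondIndep

variable {Ω E : Type*} {m₀ mΩ : MeasurableSpace Ω} {μ : Measure Ω} [IsProbabilityMeasure μ]
  [NormedAddCommGroup E] [NormedSpace ℝ E] [CompleteSpace E] [MeasurableSpace E]
  [BorelSpace E] [SecondCountableTopology E] {B : ℕ}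

/-- On the generating rectangles, `Y i` and `μ[Y i | m₀]` have the same integrals. Conditional
independence identifies the law of `Y i` under `μ` restricted to `A ∩ T` with its law under the
measure with density `μ⟦T | m₀⟧` on `A`. -/
lemma CondIndepGiven.setIntegral_eq {Y : Fin B → Ω → E} (hm : m₀ ≤ mΩ)
    (hY : ∀ i, Measurable (Y i)) (h : CondIndepGiven m₀ μ Y) {i : Fin B}
    (hint : Integrable (Y i) μ) {A : Set Ω}
    (hA : MeasurableSet[m₀] A) {D : Fin B → Set E} (hD : ∀ j, MeasurableSet (D j))
    (hDi : D i = Set.univ) :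
    ∫ ω in A ∩ ⋂ j, Y j ⁻¹' D j, Y i ω ∂μ = ∫ ω in A ∩ ⋂ j, Y j ⁻¹' D j, (μ[Y i | m₀]) ω ∂μ := by
  set T := ⋂ j, Y j ⁻¹' D j with hT
  have hTm : MeasurableSet T := MeasurableSet.iInter fun j => hY j (hD j)
  have hAm := hm _ hA
  set Z : Ω → ℝ := μ⟦T | m₀⟧ with hZ
  have hZm : StronglyMeasurable[m₀] Z := stronglyMeasurable_condExp
  have hZ0 : ∀ᵐ ω ∂μ, 0 ≤ Z ω := condExp_nonneg (ae_of_all _ fun ω =>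
    Set.indicator_nonneg (fun _ _ => zero_le_one) ω)
  have hZb : ∀ᵐ ω ∂μ, ‖Z ω‖ ≤ 1 := by
    have := ae_bdd_abs_condExp_of_ae_bdd_abs (m := m₀) (μ := μ) (R := (1 : ℝ)) (f := T.indicator fun _ => (1 : ℝ))
      (ae_of_all _ fun ω => by by_cases hω : ω ∈ T <;> simp [hω])
    simpa using this
  have hdens : Measurable fun ω => (Z ω).toNNReal := (hZm.mono hm).measurable.real_toNNReal
  have hlaw : (μ.restrict (A ∩ T)).map (Y i)
      = ((μ.restrict A).withDensity fun ω => ((Z ω).toNNReal : ENNReal)).map (Y i) := by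
    ext S hS
    rw [Measure.map_apply (hY i) hS, Measure.map_apply (hY i) hS,
      Measure.restrict_apply (hY i hS), withDensity_apply _ (hY i hS),
      Measure.restrict_restrict (hY i hS), Set.inter_comm _ (A ∩ T), Set.inter_comm _ A,
      ← ENNReal.ofReal_toReal (measure_ne_top μ (A ∩ T ∩ Y i ⁻¹' S))]
    change ENNReal.ofReal (μ.real _) = ∫⁻ ω in A ∩ Y i ⁻¹' S, ENNReal.ofReal (Z ω) ∂μ
    rw [h.setIntegral_condExp_indicator hm hY hA hD hDi hS]
    exact ofReal_integral_eq_lintegral_ofReal integrable_condExp.integrableOn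
      (ae_restrict_of_ae hZ0)
  have hpull : μ[fun ω => Z ω • Y i ω | m₀] =ᵐ[μ] fun ω => Z ω • (μ[Y i | m₀]) ω :=
    condExp_stronglyMeasurable_bilin_of_bound (.lsmul ℝ ℝ) hm hZm hint 1 hZb
  have hpull' : μ[fun ω => T.indicator (fun _ => (1 : ℝ)) ω • (μ[Y i | m₀]) ω | m₀]
      =ᵐ[μ] fun ω => Z ω • (μ[Y i | m₀]) ω := by
    refine condExp_bilin_of_stronglyMeasurable_right (.lsmul ℝ ℝ) stronglyMeasurable_condExp ?_
      ((integrable_const _).indicator hTm)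
    refine integrable_condExp.bdd_smul 1
      ((integrable_const (1 : ℝ)).indicator hTm).aestronglyMeasurable ?_
    exact ae_of_all _ fun ω => by by_cases hω : ω ∈ T <;> simp [hω]
  have hi1 : Integrable (fun ω => Z ω • Y i ω) μ :=
    hint.bdd_smul 1 integrable_condExp.aestronglyMeasurable hZb
  have hi2 : Integrable (fun ω => T.indicator (fun _ => (1 : ℝ)) ω • (μ[Y i | m₀]) ω) μ :=
    integrable_condExp.bdd_smul 1
      ((integrable_const (1 : ℝ)).indicator hTm).aestronglyMeasurable
      (ae_of_all _ fun ω => by by_cases hω : ω ∈ T <;> simp [hω])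
  calc ∫ ω in A ∩ T, Y i ω ∂μ = ∫ y, y ∂((μ.restrict (A ∩ T)).map (Y i)) :=
        (integral_map (hY i).aemeasurable aestronglyMeasurable_id).symm
    _ = ∫ ω, Y i ω ∂((μ.restrict A).withDensity fun ω => ((Z ω).toNNReal : ENNReal)) := by
        rw [hlaw]; exact integral_map (hY i).aemeasurable aestronglyMeasurable_id
    _ = ∫ ω in A, (Z ω).toNNReal • Y i ω ∂μ := integral_withDensity_eq_integral_smul hdens _
    _ = ∫ ω in A, Z ω • Y i ω ∂μ :=
        integral_congr_ae (ae_restrict_of_ae (by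
          filter_upwards [hZ0] with ω hω
          rw [NNReal.smul_def, Real.coe_toNNReal _ hω]))
    _ = ∫ ω in A, (μ[fun ω => Z ω • Y i ω | m₀]) ω ∂μ := (setIntegral_condExp hm hi1 hA).symm
    _ = ∫ ω in A, (μ[fun ω => T.indicator (fun _ => (1 : ℝ)) ω • (μ[Y i | m₀]) ω | m₀]) ω ∂μ :=
        integral_congr_ae (ae_restrict_of_ae (hpull.trans hpull'.symm))
    _ = ∫ ω in A, T.indicator (fun _ => (1 : ℝ)) ω • (μ[Y i | m₀]) ω ∂μ :=
        setIntegral_condExp hm hi2 hA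
    _ = ∫ ω in A, T.indicator (μ[Y i | m₀]) ω ∂μ := by
        congr 1; ext ω
        by_cases hω : ω ∈ T <;> simp [hω]
    _ = ∫ ω in A ∩ T, (μ[Y i | m₀]) ω ∂μ := setIntegral_indicator hTm

/-- Given `m₀`, the earlier `Y j` carry no information about the conditional mean of `Y i`. -/
theorem CondIndepGiven.condExp_revealFiltration {Y : Fin B → Ω → E} (hm : m₀ ≤ mΩ)
    (hY : ∀ i, Measurable (Y i)) (h : CondIndepGiven m₀ μ Y) (i : Fin B)
    (hint : Integrable (Y i) μ) :
    μ[Y i | revealFiltration hm Y hY i] =ᵐ[μ] μ[Y i | m₀] := by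
  have hle := (revealFiltration hm Y hY).le i
  refine (ae_eq_condExp_of_forall_setIntegral_eq hle hint
    (fun s _ _ => integrable_condExp.integrableOn) (fun s hs _ => ?_)
    ((stronglyMeasurable_condExp (f := Y i) (μ := μ)).mono
      (le_revealFiltration hm Y hY i)).aestronglyMeasurable).symm
  refine Eq.symm ?_
  refine MeasurableSpace.induction_on_inter
    (C := fun s _ => ∫ ω in s, Y i ω ∂μ = ∫ ω in s, (μ[Y i | m₀]) ω ∂μ)
    (revealFiltration_eq_generateFrom hm Y hY i) (isPiSystem_revealRectangles Y i)
    (by simp) ?_ ?_ ?_ s hs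
  · rintro _ ⟨A, hA, D, hD, hDi, rfl⟩
    exact h.setIntegral_eq hm hY hint hA hD (hDi i le_rfl)
  · intro t ht ih
    rw [setIntegral_compl (hle _ ht) hint, setIntegral_compl (hle _ ht) integrable_condExp, ih,
      integral_condExp hm]
  · intro F hdisj hF ih
    rw [integral_iUnion (fun j => hle _ (hF j)) hdisj hint.integrableOn,
      integral_iUnion (fun j => hle _ (hF j)) hdisj integrable_condExp.integrableOn]
    exact tsum_congr ih

end CondIndep

/-! ### Conditional moments of mini-batch noise -/

/-- Averaging `B` conditionally independent samples reduces the conditional `p`-th moment of the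
noise by the factor `2 * B ^ (1 - p)`. -/
theorem CondIndepGiven.condExp_norm_batch_rpow_le {Ω E : Type*} {m₀ mΩ : MeasurableSpace Ω}
    {μ : Measure Ω} [IsProbabilityMeasure μ] [NormedAddCommGroup E] [InnerProductSpace ℝ E]
    [CompleteSpace E] [MeasurableSpace E] [BorelSpace E] [SecondCountableTopology E] {B : ℕ}
    (hB : 0 < B) {p : ℝ} (hp1 : 1 ≤ p) (hp2 : p ≤ 2) (hm : m₀ ≤ mΩ) {Y : Fin B → Ω → E}
    (hY : ∀ i, Measurable (Y i)) (h : CondIndepGiven m₀ μ Y) (hint : ∀ i, Integrable (Y i) μ)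
    {g : Ω → E} (hg : StronglyMeasurable[m₀] g) (hmean : ∀ i, μ[Y i | m₀] =ᵐ[μ] g)
    (hLp : ∀ i, Integrable (fun ω => ‖Y i ω - g ω‖ ^ p) μ) {v : Ω → ℝ}
    (hv : StronglyMeasurable[m₀] v) (hvi : Integrable v μ)
    (hle : ∀ i, μ[fun ω => ‖Y i ω - g ω‖ ^ p | m₀] ≤ᵐ[μ] v) :
    MemLp (fun ω => (B : ℝ)⁻¹ • ∑ i, Y i ω - g ω) (ENNReal.ofReal p) μ ∧
    μ[fun ω => ‖(B : ℝ)⁻¹ • ∑ i, Y i ω - g ω‖ ^ p | m₀]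
      ≤ᵐ[μ] fun ω => 2 * (B : ℝ) ^ (1 - p) * v ω := by
  have hp0 : 0 < p := by linarith
  have hB' : (0 : ℝ) < B := by exact_mod_cast hB
  have hgm : StronglyMeasurable g := hg.mono hm
  have hgi : Integrable g μ := (integrable_congr (hmean ⟨0, hB⟩)).1 integrable_condExp
  have hLp' : ∀ i, MemLp (fun ω => Y i ω - g ω) (ENNReal.ofReal p) μ := fun i =>
    ((hint i).sub hgi).aestronglyMeasurable.memLp_of_integrable_norm_rpow hp0 (hLp i)
  have hsum : ∀ ω, (B : ℝ)⁻¹ • ∑ i, Y i ω - g ω = ∑ i, (B : ℝ)⁻¹ • (Y i ω - g ω) := fun ω => by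
    rw [← Finset.smul_sum, Finset.sum_sub_distrib, smul_sub, Finset.sum_const, Finset.card_univ,
      Fintype.card_fin, ← Nat.cast_smul_eq_nsmul ℝ, inv_smul_smul₀ hB'.ne']
  have hNLp : MemLp (fun ω => (B : ℝ)⁻¹ • ∑ i, Y i ω - g ω) (ENNReal.ofReal p) μ := by
    simp only [hsum]
    exact memLp_finsetSum _ fun i _ => (hLp' i).const_smul _
  refine ⟨hNLp, ?_⟩
  have hNi := hNLp.integrable_norm_rpow_ofReal hp0
  have hset : ∀ A, MeasurableSet[m₀] A →
      ∫ ω in A, ‖(B : ℝ)⁻¹ • ∑ i, Y i ω - g ω‖ ^ p ∂μ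
        ≤ ∫ ω in A, 2 * (B : ℝ) ^ (1 - p) * v ω ∂μ := by
    intro A hA
    have hAm := hm _ hA
    -- The centered samples, restricted to `A`, are martingale differences as they are revealed.
    set ξ : ℕ → Ω → E := fun i => if hi : i < B then
      A.indicator (fun ω => (B : ℝ)⁻¹ • (Y ⟨i, hi⟩ ω - g ω)) else 0 with hξ
    have hξi : ∀ i : Fin B, ξ i = A.indicator (fun ω => (B : ℝ)⁻¹ • (Y i ω - g ω)) := fun i => by
      simp [hξ]
    have hnorm : ∀ (i : Fin B) ω, ‖ξ i ω‖ ^ p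
        = A.indicator (fun ω => (B : ℝ)⁻¹ ^ p * ‖Y i ω - g ω‖ ^ p) ω := by
      intro i ω
      rw [hξi]
      by_cases hω : ω ∈ A
      · simp only [Set.indicator_of_mem hω]
        rw [norm_smul, Real.norm_of_nonneg (by positivity),
          Real.mul_rpow (by positivity) (norm_nonneg _)]
      · simp [hω, Real.zero_rpow hp0.ne']
    have hvbe := integral_norm_sum_rpow_le (μ := μ) hp1 hp2 (revealFiltration hm Y hY) ξ B
      (fun i hi => by
        rw [hξi ⟨i, hi⟩]
        have hle' := le_revealFiltration hm Y hY (i + 1)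
        refine StronglyMeasurable.indicator ?_ (hle' _ hA)
        have hYi := (measurable_revealFiltration_succ hm Y hY ⟨i, hi⟩).stronglyMeasurable
        exact (hYi.sub (hg.mono hle')).const_smul _)
      (fun i hi => by
        rw [hξi ⟨i, hi⟩]
        exact ((hLp' ⟨i, hi⟩).const_smul _).indicator hAm)
      (fun i hi => by
        rw [hξi ⟨i, hi⟩]
        have hle' := le_revealFiltration hm Y hY i
        have hii : Integrable (Y ⟨i, hi⟩ - g) μ := (hint ⟨i, hi⟩).sub hgi
        refine (condExp_indicator (hii.smul (B : ℝ)⁻¹) (hle' _ hA)).trans ?_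
        filter_upwards [condExp_smul (μ := μ) (B : ℝ)⁻¹ (Y ⟨i, hi⟩ - g) (revealFiltration hm Y hY i),
          condExp_sub (hint ⟨i, hi⟩) hgi (revealFiltration hm Y hY i),
          h.condExp_revealFiltration hm hY ⟨i, hi⟩ (hint _), hmean ⟨i, hi⟩] with ω h1 h2 h3 h4
        by_cases hω : ω ∈ A
        · rw [Set.indicator_of_mem hω, h1, Pi.smul_apply, h2, Pi.sub_apply, h3, h4,
            condExp_of_stronglyMeasurable ((revealFiltration hm Y hY).le i) (hg.mono hle') hgi]
          simp
        · simp [hω])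
    calc ∫ ω in A, ‖(B : ℝ)⁻¹ • ∑ i, Y i ω - g ω‖ ^ p ∂μ
        = ∫ ω, ‖∑ i ∈ Finset.range B, ξ i ω‖ ^ p ∂μ := by
          rw [← integral_indicator hAm]
          congr 1; ext ω
          rw [Finset.sum_range]
          simp only [hξi]
          by_cases hω : ω ∈ A
          · simp only [Set.indicator_of_mem hω, hsum]
          · simp [hω, Real.zero_rpow hp0.ne']
      _ ≤ 2 * ∑ i ∈ Finset.range B, ∫ ω, ‖ξ i ω‖ ^ p ∂μ := hvbe
      _ ≤ 2 * ∑ _i : Fin B, (B : ℝ)⁻¹ ^ p * ∫ ω in A, v ω ∂μ := by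
          rw [Finset.sum_range]
          refine mul_le_mul_of_nonneg_left (Finset.sum_le_sum fun i _ => ?_) zero_le_two
          simp only [hnorm]
          rw [integral_indicator hAm, integral_const_mul]
          refine mul_le_mul_of_nonneg_left ?_ (by positivity)
          rw [← setIntegral_condExp hm (hLp i) hA]
          exact setIntegral_mono_ae integrable_condExp.integrableOn hvi.integrableOn (hle i)
      _ = ∫ ω in A, 2 * (B : ℝ) ^ (1 - p) * v ω ∂μ := by
          rw [integral_const_mul, Finset.sum_const, Finset.card_univ, Fintype.card_fin,
            nsmul_eq_mul, Real.rpow_sub hB', Real.rpow_one, Real.inv_rpow hB'.le]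
          ring
  have hvi' : Integrable (fun ω => 2 * (B : ℝ) ^ (1 - p) * v ω) μ := hvi.const_mul _
  have hvs : StronglyMeasurable[m₀] (fun ω => 2 * (B : ℝ) ^ (1 - p) * v ω) := hv.const_mul _
  refine ae_le_of_ae_le_trim (hm := hm) ?_
  refine ae_le_of_forall_setIntegral_le (integrable_condExp.trim hm stronglyMeasurable_condExp)
    (hvi'.trim hm hvs) fun A hA _ => ?_
  rw [← setIntegral_trim hm stronglyMeasurable_condExp hA, ← setIntegral_trim hm hvs hA,
    setIntegral_condExp hm hNi hA]
  exact hset A hA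

/-! ### Discounted sums of heavy-tailed noise -/

lemma norm_discountedSum_le {E : Type*} [NormedAddCommGroup E] [NormedSpace ℝ E] {β b : ℝ}
    (hβ0 : 0 ≤ β) (hβ1 : β < 1) {N : ℕ → E} {k : ℕ} (hN : ∀ j < k, ‖N j‖ ≤ b) (hb : 0 ≤ b) :
    ‖discountedSum β N k‖ ≤ b / (1 - β) := by
  have h1 : 0 < 1 - β := by linarith
  induction k with
  | zero => rw [discountedSum_zero, norm_zero]; positivity
  | succ k ih =>
    rw [discountedSum_succ]
    refine (norm_add_le _ _).trans ?_
    rw [norm_smul, Real.norm_of_nonneg hβ0]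
    have h2 := mul_le_mul_of_nonneg_left (ih fun j hj => hN j (by omega)) hβ0
    have h3 : β * (b / (1 - β)) + b = b / (1 - β) := by field_simp; ring
    linarith [hN k (by omega)]

lemma sum_discountedSum_le {β : ℝ} (hβ0 : 0 ≤ β) (hβ1 : β < 1) {γ : ℕ → ℝ} (hγ : ∀ j, 0 ≤ γ j)
    (K : ℕ) :
    ∑ k ∈ Finset.range K, discountedSum β γ (k + 1) ≤ (∑ k ∈ Finset.range K, γ k) / (1 - β) := by
  have key : (1 - β) * ∑ k ∈ Finset.range K, discountedSum β γ (k + 1) + β * discountedSum β γ K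
      = ∑ k ∈ Finset.range K, γ k := by
    induction K with
    | zero => simp [discountedSum_zero]
    | succ K ih =>
      rw [Finset.sum_range_succ, Finset.sum_range_succ, ← ih, discountedSum_succ, smul_eq_mul]
      ring
  rw [le_div_iff₀ (by linarith)]
  have : 0 ≤ β * discountedSum β γ K := mul_nonneg hβ0
    (Finset.sum_nonneg fun j _ => mul_nonneg (pow_nonneg hβ0 _) (hγ j))
  linarith

lemma discountedSum_add {E : Type*} [AddCommGroup E] [Module ℝ E] (β : ℝ) (N N' : ℕ → E) (k : ℕ) :
    discountedSum β (fun j => N j + N' j) k = discountedSum β N k + discountedSum β N' k := by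
  simp only [discountedSum, smul_add, Finset.sum_add_distrib]

lemma integral_le_rpow_integral_rpow {Ω : Type*} {mΩ : MeasurableSpace Ω} {μ : Measure Ω}
    [IsProbabilityMeasure μ] {p : ℝ} (hp : 1 ≤ p) {x : Ω → ℝ} (hx0 : ∀ ω, 0 ≤ x ω)
    (hx : Integrable x μ) (hxp : Integrable (fun ω => x ω ^ p) μ) :
    ∫ ω, x ω ∂μ ≤ (∫ ω, x ω ^ p ∂μ) ^ (1 / p) := by
  have hp0 : 0 < p := by linarith
  have h := (convexOn_rpow hp).map_integral_le
    (Real.continuous_rpow_const hp0.le).continuousOn isClosed_Ici (ae_of_all _ hx0) hx hxp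
  have h0 : 0 ≤ ∫ ω, x ω ∂μ := integral_nonneg hx0
  calc ∫ ω, x ω ∂μ = ((∫ ω, x ω ∂μ) ^ p) ^ (1 / p) := by
        rw [← Real.rpow_mul h0, mul_one_div_cancel hp0.ne', Real.rpow_one]
    _ ≤ _ := Real.rpow_le_rpow (by positivity) h (by positivity)

/-- Martingale difference noise whose conditional `p`-th moments are at most `(a + b γ k) ^ p`, for
a nonnegative predictable process `γ` bounded by `Γ`. -/
structure PredictableNoise {Ω E : Type*} {mΩ : MeasurableSpace Ω} [NormedAddCommGroup E]
    [InnerProductSpace ℝ E] [CompleteSpace E] (μ : Measure Ω) (𝓕 : Filtration ℕ mΩ) (p a b Γ : ℝ)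
    (K : ℕ) (N : ℕ → Ω → E) (γ : ℕ → Ω → ℝ) : Prop where
  adapted : ∀ k < K, StronglyMeasurable[𝓕 (k + 1)] (N k)
  memLp : ∀ k < K, MemLp (N k) (ENNReal.ofReal p) μ
  condExp_eq : ∀ k < K, μ[N k | 𝓕 k] =ᵐ[μ] 0
  predictable : ∀ k < K, StronglyMeasurable[𝓕 k] (γ k)
  nonneg : ∀ k ω, 0 ≤ γ k ω
  bounded : ∀ k < K, ∀ ω, γ k ω ≤ Γ
  moment_le : ∀ k < K, μ[fun ω => ‖N k ω‖ ^ p | 𝓕 k] ≤ᵐ[μ] fun ω => (a + b * γ k ω) ^ p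

namespace PredictableNoise

variable {Ω E : Type*} {mΩ : MeasurableSpace Ω} {μ : Measure Ω}
  [NormedAddCommGroup E] [InnerProductSpace ℝ E] [CompleteSpace E]
  {𝓕 : Filtration ℕ mΩ} {p a b Γ : ℝ} {K : ℕ} {N : ℕ → Ω → E} {γ : ℕ → Ω → ℝ}

lemma condExp_norm_le (h : PredictableNoise μ 𝓕 p a b Γ K N γ) (hp1 : 1 ≤ p) (ha : 0 ≤ a)
    (hb : 0 ≤ b) {k : ℕ} (hk : k < K) :
    μ[fun ω => ‖N k ω‖ | 𝓕 k] ≤ᵐ[μ] fun ω => a + b * γ k ω := by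
  have hp0 : 0 < p := by linarith
  have hi := (h.memLp k hk).integrable_norm_rpow_ofReal hp0
  have hj := Integrable.norm_condExp_rpow_le (m := 𝓕 k) (f := fun ω => ‖N k ω‖) hp1
    (by simpa only [norm_norm] using hi)
  filter_upwards [hj, h.moment_le k hk] with ω h1 h2
  simp only [norm_norm] at h1
  have h3 : 0 ≤ a + b * γ k ω := add_nonneg ha (mul_nonneg hb (h.nonneg k ω))
  have h4 := (Real.rpow_le_rpow_iff (norm_nonneg _) h3 hp0).1 (h1.trans h2)
  exact (le_abs_self _).trans h4

variable [IsProbabilityMeasure μ]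

lemma integrable (h : PredictableNoise μ 𝓕 p a b Γ K N γ) (hp1 : 1 ≤ p) {k : ℕ} (hk : k < K) :
    Integrable (N k) μ := (h.memLp k hk).integrable (by simpa using hp1)

lemma integrable_bound (h : PredictableNoise μ 𝓕 p a b Γ K N γ) {k : ℕ} (hk : k < K) :
    Integrable (γ k) μ :=
  Integrable.of_bound ((h.predictable k hk).mono (𝓕.le k)).aestronglyMeasurable Γ
    (ae_of_all _ fun ω => by
      rw [Real.norm_of_nonneg (h.nonneg k ω)]; exact h.bounded k hk ω)

/-- Integration of `w ‖N k‖` against a predictable weight `w ∈ [0, 1]`. -/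
lemma integral_weight_mul_norm_le (h : PredictableNoise μ 𝓕 p a b Γ K N γ) (hp1 : 1 ≤ p)
    (ha : 0 ≤ a) (hb : 0 ≤ b) {k : ℕ} (hk : k < K) {w : Ω → ℝ} (hw : StronglyMeasurable[𝓕 k] w)
    (hw0 : ∀ ω, 0 ≤ w ω) (hw1 : ∀ ω, w ω ≤ 1) :
    ∫ ω, w ω * ‖N k ω‖ ∂μ ≤ ∫ ω, w ω * (a + b * γ k ω) ∂μ := by
  have hwb : ∀ᵐ ω ∂μ, ‖w ω‖ ≤ 1 := ae_of_all _ fun ω => by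
    rw [Real.norm_of_nonneg (hw0 ω)]; exact hw1 ω
  have hwm := (hw.mono (𝓕.le k)).aestronglyMeasurable (μ := μ)
  have hpull := condExp_stronglyMeasurable_mul_of_bound (𝓕.le k) hw (h.integrable hp1 hk).norm 1 hwb
  rw [← integral_condExp (𝓕.le k) (f := fun ω => w ω * ‖N k ω‖)]
  refine integral_mono_ae integrable_condExp
    (((integrable_const a).add ((h.integrable_bound hk).const_mul b)).bdd_mul hwm hwb) ?_
  filter_upwards [hpull, h.condExp_norm_le hp1 ha hb hk] with ω h1 h2
  exact h1.trans_le (mul_le_mul_of_nonneg_left h2 (hw0 ω))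

lemma integral_norm_le (h : PredictableNoise μ 𝓕 p a b Γ K N γ) (hp1 : 1 ≤ p)
    (ha : 0 ≤ a) (hb : 0 ≤ b) {k : ℕ} (hk : k < K) :
    ∫ ω, ‖N k ω‖ ∂μ ≤ a + b * ∫ ω, γ k ω ∂μ := by
  have := h.integral_weight_mul_norm_le hp1 ha hb hk (w := fun _ => 1)
    stronglyMeasurable_const (fun _ => zero_le_one) fun _ => le_rfl
  simp only [one_mul] at this
  rwa [integral_add (integrable_const a) ((h.integrable_bound hk).const_mul b),
    integral_const_mul, integral_const, probReal_univ, one_smul] at this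

lemma integral_weight_smul_norm_rpow_le (h : PredictableNoise μ 𝓕 p a b Γ K N γ) (hp1 : 1 ≤ p)
    (ha : 0 ≤ a) (hb : 0 ≤ b) {k : ℕ} (hk : k < K) {w : Ω → ℝ} (hw : StronglyMeasurable[𝓕 k] w)
    (hw0 : ∀ ω, 0 ≤ w ω) (hw1 : ∀ ω, w ω ≤ 1) (hwa : ∀ ω, w ω * (a + b * γ k ω) ≤ a) :
    ∫ ω, ‖w ω • N k ω‖ ^ p ∂μ ≤ a ^ p := by
  have hp0 : 0 < p := by linarith
  have hi := (h.memLp k hk).integrable_norm_rpow_ofReal hp0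
  have hwp : StronglyMeasurable[𝓕 k] fun ω => w ω ^ p :=
    (Real.continuous_rpow_const hp0.le).comp_stronglyMeasurable hw
  have hwb : ∀ᵐ ω ∂μ, ‖w ω ^ p‖ ≤ 1 := ae_of_all _ fun ω => by
    rw [Real.norm_of_nonneg (Real.rpow_nonneg (hw0 ω) p)]
    exact Real.rpow_le_one (hw0 ω) (hw1 ω) hp0.le
  have hpull := condExp_stronglyMeasurable_mul_of_bound (𝓕.le k) hwp hi 1 hwb
  have heq : ∀ ω, ‖w ω • N k ω‖ ^ p = w ω ^ p * ‖N k ω‖ ^ p := fun ω => by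
    rw [norm_smul, Real.norm_of_nonneg (hw0 ω), Real.mul_rpow (hw0 ω) (norm_nonneg _)]
  simp only [heq]
  rw [← integral_condExp (𝓕.le k)]
  refine (integral_mono_ae (g := fun _ => a ^ p) integrable_condExp (integrable_const _) ?_).trans
    (by simp)
  filter_upwards [hpull, h.moment_le k hk] with ω h1 h2
  have h3 : 0 ≤ a + b * γ k ω := add_nonneg ha (mul_nonneg hb (h.nonneg k ω))
  refine h1.trans_le ((mul_le_mul_of_nonneg_left h2 (Real.rpow_nonneg (hw0 ω) p)).trans ?_)
  rw [← Real.mul_rpow (hw0 ω) h3]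
  exact Real.rpow_le_rpow (mul_nonneg (hw0 ω) h3) (hwa ω) hp0.le

/-- The first moment of a discounted sum of noise. The predictable weight `w j = a / (a + b γ j)`
splits the noise into `w j • N j`, whose conditional `p`-th moments are at most `a ^ p`, so that the
von Bahr–Esseen inequality gains a power of `1 - β`, and `(1 - w j) • N j`, whose conditional first
moments are at most `b γ j`, so that the triangle inequality suffices and keeps the bound linear in
`γ`. -/
theorem integral_norm_discountedSum_le (h : PredictableNoise μ 𝓕 p a b Γ K N γ) (hp1 : 1 ≤ p)
    (hp2 : p ≤ 2) (ha : 0 ≤ a) (hb : 0 ≤ b) {β : ℝ} (hβ0 : 0 ≤ β) (hβ1 : β < 1) {k : ℕ}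
    (hk : k ≤ K) :
    ∫ ω, ‖discountedSum β (fun j => N j ω) k‖ ∂μ
      ≤ (2 * (a ^ p / (1 - β))) ^ (1 / p)
        + b * discountedSum β (fun j => ∫ ω, γ j ω ∂μ) k := by
  have hp0 : 0 < p := by linarith
  have hone : 1 ≤ ENNReal.ofReal p := by simpa using hp1
  have h1β : 0 < 1 - β := by linarith
  -- Where `a + b γ j = 0`, the weight is `0 / 0 = 0` and the noise vanishes almost surely.
  set w : ℕ → Ω → ℝ := fun j ω => a / (a + b * γ j ω) with hw
  have hs : ∀ j ω, 0 ≤ a + b * γ j ω := fun j ω => add_nonneg ha (mul_nonneg hb (h.nonneg j ω))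
  have hw0 : ∀ j ω, 0 ≤ w j ω := fun j ω => div_nonneg ha (hs j ω)
  have hw1 : ∀ j ω, w j ω ≤ 1 := fun j ω => div_le_one_of_le₀
    (le_add_of_nonneg_right (mul_nonneg hb (h.nonneg j ω))) (hs j ω)
  have hwa : ∀ j ω, w j ω * (a + b * γ j ω) ≤ a := fun j ω => by
    rcases (hs j ω).eq_or_lt with h0 | h0
    · rwa [← h0, mul_zero]
    · exact (div_mul_cancel₀ a h0.ne').le
  have hwb : ∀ j ω, (1 - w j ω) * (a + b * γ j ω) = b * γ j ω := by
    intro j ω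
    rcases (hs j ω).eq_or_lt with h0 | h0
    · have := mul_nonneg hb (h.nonneg j ω)
      rw [← h0, mul_zero]
      linarith
    · have : w j ω * (a + b * γ j ω) = a := div_mul_cancel₀ a h0.ne'
      linarith
  have hwm : ∀ j < K, StronglyMeasurable[𝓕 j] (w j) := fun j hj =>
    (measurable_const.div (measurable_const.add
      ((h.predictable j hj).measurable.const_mul b))).stronglyMeasurable
  have hP : ∀ j < K, MemLp (fun ω => w j ω • N j ω) (ENNReal.ofReal p) μ := fun j hj =>
    (h.memLp j hj).of_le (((hwm j hj).mono (𝓕.le j)).aestronglyMeasurable.smul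
      (h.memLp j hj).aestronglyMeasurable) (ae_of_all _ fun ω => by
        rw [norm_smul, Real.norm_of_nonneg (hw0 j ω)]
        exact mul_le_of_le_one_left (norm_nonneg _) (hw1 j ω))
  have hQ : ∀ j < K, Integrable (fun ω => (1 - w j ω) • N j ω) μ := fun j hj => by
    have := (h.integrable hp1 hj).sub ((hP j hj).integrable hone)
    refine this.congr (ae_of_all _ fun ω => ?_)
    simp only [Pi.sub_apply, sub_smul, one_smul]
  have hlt : ∀ j ∈ Finset.range k, j < K := fun j hj => (Finset.mem_range.1 hj).trans_le hk
  have hsplit : ∀ ω, discountedSum β (fun j => N j ω) k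
      = discountedSum β (fun j => w j ω • N j ω) k
        + discountedSum β (fun j => (1 - w j ω) • N j ω) k := fun ω => by
    rw [← discountedSum_add]
    congr 1; ext j
    rw [← add_smul, add_sub_cancel, one_smul]
  have hPsum : MemLp (fun ω => discountedSum β (fun j => w j ω • N j ω) k) (ENNReal.ofReal p) μ :=
    memLp_finsetSum _ fun j hj => (hP j (hlt j hj)).const_smul _
  have hQsum : Integrable (fun ω => discountedSum β (fun j => (1 - w j ω) • N j ω) k) μ :=
    integrable_finsetSum _ fun j hj => (hQ j (hlt j hj)).smul _
  have hone' : ∀ x : ℝ, 0 ≤ x → x ≤ 1 → x ^ p ≤ x := fun x h0 h1 => by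
    simpa using Real.rpow_le_rpow_of_exponent_ge_of_imp h0 h1 hp1 (by intro _ h; linarith)
  have hbound1 : ∫ ω, ‖discountedSum β (fun j => w j ω • N j ω) k‖ ∂μ
      ≤ (2 * (a ^ p / (1 - β))) ^ (1 / p) := by
    refine (integral_le_rpow_integral_rpow hp1 (fun _ => norm_nonneg _)
      (hPsum.integrable hone).norm (hPsum.integrable_norm_rpow_ofReal hp0)).trans ?_
    refine Real.rpow_le_rpow (integral_nonneg fun _ => by positivity) ?_ (by positivity)
    refine (integral_norm_sum_rpow_le hp1 hp2 𝓕 (fun j ω => β ^ (k - 1 - j) • w j ω • N j ω) k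
      (fun j hj => (((hwm j (hj.trans_le hk)).mono (𝓕.mono (Nat.le_succ j))).smul
        (h.adapted j (hj.trans_le hk))).const_smul _)
      (fun j hj => (hP j (hj.trans_le hk)).const_smul _) (fun j hj => ?_)).trans ?_
    · have hjK := hj.trans_le hk
      have hpull : μ[fun ω => w j ω • N j ω | 𝓕 j] =ᵐ[μ] fun ω => w j ω • (μ[N j | 𝓕 j]) ω :=
        condExp_bilin_of_stronglyMeasurable_left (.lsmul ℝ ℝ) (hwm j hjK)
          ((hP j hjK).integrable hone) (h.integrable hp1 hjK)
      filter_upwards [condExp_smul (μ := μ) (β ^ (k - 1 - j)) (fun ω => w j ω • N j ω) (𝓕 j),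
        hpull, h.condExp_eq j hjK] with ω h1 h2 h3
      refine h1.trans ?_
      rw [Pi.smul_apply, h2, h3]
      simp
    · refine mul_le_mul_of_nonneg_left ?_ zero_le_two
      calc ∑ j ∈ Finset.range k, ∫ ω, ‖β ^ (k - 1 - j) • w j ω • N j ω‖ ^ p ∂μ
          ≤ ∑ j ∈ Finset.range k, β ^ (k - 1 - j) • a ^ p := by
            refine Finset.sum_le_sum fun j hj => ?_
            have hq0 : 0 ≤ β ^ (k - 1 - j) := pow_nonneg hβ0 _
            have heq : ∀ ω, ‖β ^ (k - 1 - j) • w j ω • N j ω‖ ^ p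
                = (β ^ (k - 1 - j)) ^ p * ‖w j ω • N j ω‖ ^ p := fun ω => by
              rw [norm_smul, Real.norm_of_nonneg hq0, Real.mul_rpow hq0 (norm_nonneg _)]
            simp only [heq]
            rw [integral_const_mul, smul_eq_mul]
            exact mul_le_mul (hone' _ hq0 (pow_le_one₀ hβ0 hβ1.le))
              (h.integral_weight_smul_norm_rpow_le hp1 ha hb (hlt j hj) (hwm j (hlt j hj))
                (hw0 j) (hw1 j) (hwa j)) (integral_nonneg fun _ => by positivity) hq0
        _ ≤ a ^ p / (1 - β) := (le_abs_self _).trans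
            (norm_discountedSum_le hβ0 hβ1 (N := fun _ => a ^ p)
              (fun _ _ => (Real.norm_of_nonneg (by positivity)).le) (by positivity))
  have hbound2 : ∫ ω, ‖discountedSum β (fun j => (1 - w j ω) • N j ω) k‖ ∂μ
      ≤ b * discountedSum β (fun j => ∫ ω, γ j ω ∂μ) k := by
    calc ∫ ω, ‖discountedSum β (fun j => (1 - w j ω) • N j ω) k‖ ∂μ
        ≤ ∫ ω, ∑ j ∈ Finset.range k, β ^ (k - 1 - j) * ‖(1 - w j ω) • N j ω‖ ∂μ := by
          refine integral_mono hQsum.norm (integrable_finsetSum _ fun j hj =>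
            (hQ j (hlt j hj)).norm.const_mul _) fun ω => ?_
          refine (norm_sum_le _ _).trans_eq (Finset.sum_congr rfl fun j _ => ?_)
          rw [norm_smul (β ^ (k - 1 - j)), Real.norm_of_nonneg (pow_nonneg hβ0 _)]
      _ = ∑ j ∈ Finset.range k, β ^ (k - 1 - j) * ∫ ω, ‖(1 - w j ω) • N j ω‖ ∂μ := by
          rw [integral_finsetSum _ fun j hj => (hQ j (hlt j hj)).norm.const_mul _]
          simp only [integral_const_mul]
      _ ≤ ∑ j ∈ Finset.range k, β ^ (k - 1 - j) * (b * ∫ ω, γ j ω ∂μ) := by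
          refine Finset.sum_le_sum fun j hj =>
            mul_le_mul_of_nonneg_left ?_ (pow_nonneg hβ0 _)
          have hjK := hlt j hj
          have := h.integral_weight_mul_norm_le hp1 ha hb hjK (w := fun ω => 1 - w j ω)
            (stronglyMeasurable_const.sub (hwm j hjK)) (fun ω => sub_nonneg.2 (hw1 j ω))
            (fun ω => sub_le_self _ (hw0 j ω))
          simp only [hwb, integral_const_mul] at this
          refine le_of_eq_of_le ?_ this
          congr 1; ext ω
          rw [norm_smul, Real.norm_of_nonneg (sub_nonneg.2 (hw1 j ω))]
      _ = b * discountedSum β (fun j => ∫ ω, γ j ω ∂μ) k := by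
          rw [discountedSum, Finset.mul_sum]
          refine Finset.sum_congr rfl fun j _ => ?_
          rw [smul_eq_mul]; ring
  calc ∫ ω, ‖discountedSum β (fun j => N j ω) k‖ ∂μ
      ≤ ∫ ω, (‖discountedSum β (fun j => w j ω • N j ω) k‖
          + ‖discountedSum β (fun j => (1 - w j ω) • N j ω) k‖) ∂μ := by
        refine integral_mono ?_ ((hPsum.integrable hone).norm.add hQsum.norm) fun ω => ?_
        · exact (integrable_finsetSum _ fun j hj =>
            (h.integrable hp1 (hlt j hj)).smul (β ^ (k - 1 - j))).norm
        · simp only [hsplit]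
          exact norm_add_le _ _
    _ ≤ _ := by
        rw [integral_add (hPsum.integrable hone).norm hQsum.norm]
        exact add_le_add hbound1 hbound2

end PredictableNoise

/-! ### The noise of a run of Muon -/

/-- The factor `(2 B ^ (1 - α)) ^ (1 / α)` by which a mini-batch of size `B` scales the noise
parameters `σ₀` and `σ₁`. -/
noncomputable def batchFactor (α : ℝ) (B : ℕ) : ℝ := (2 * (B : ℝ) ^ (1 - α)) ^ (1 / α)

lemma batchFactor_nonneg (α : ℝ) (B : ℕ) : 0 ≤ batchFactor α B := by
  unfold batchFactor; positivity

lemma batchFactor_eq (α : ℝ) {B : ℕ} (hB : 0 < B) :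
    batchFactor α B = 2 ^ (1 / α) / (B : ℝ) ^ ((α - 1) / α) := by
  have hB' : (0 : ℝ) < B := by exact_mod_cast hB
  rw [batchFactor, Real.mul_rpow (by norm_num) (by positivity), ← Real.rpow_mul hB'.le,
    div_eq_mul_inv _ ((B : ℝ) ^ ((α - 1) / α)), ← Real.rpow_neg hB'.le]
  congr 2
  ring

lemma batchFactor_le {α : ℝ} (hα : 1 < α) {B : ℕ} (hB : 0 < B) :
    batchFactor α B ≤ 2 / (B : ℝ) ^ ((α - 1) / α) := by
  rw [batchFactor_eq α hB]
  gcongr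
  exact Real.rpow_le_self_of_one_le (by norm_num) ((div_le_one (by linarith)).2 hα.le)

section Noise

variable {m n B : ℕ} {Ω : Type*} {mΩ : MeasurableSpace Ω} {μ : Measure Ω} {𝓕 : Filtration ℕ mΩ}
  {f : Mat m n → ℝ} {α σ₀ σ₁ L Γ : ℝ} {K : ℕ} {G : ℕ → Fin B → Ω → Mat m n}
  {X : ℕ → Ω → Mat m n}

lemma HeavyTailedNoise.stronglyMeasurable_gradient (h : HeavyTailedNoise μ 𝓕 f α σ₀ σ₁ K G X)
    (hf : LSmooth f L) (hL : 0 ≤ L) {k : ℕ} (hk : k < K) :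
    StronglyMeasurable[𝓕 k] fun ω => ∇ f (X k ω) :=
  (hf.continuous_gradient hL).comp_stronglyMeasurable (h.adapted_X k hk)

variable [IsProbabilityMeasure μ]

lemma HeavyTailedNoise.integrable_gradient (h : HeavyTailedNoise μ 𝓕 f α σ₀ σ₁ K G X)
    (hf : LSmooth f L) (hL : 0 ≤ L) (hΓ : ∀ k < K, ∀ ω, ‖∇ f (X k ω)‖ ≤ Γ) {k : ℕ} (hk : k < K) :
    Integrable (fun ω => ∇ f (X k ω)) μ :=
  Integrable.of_bound ((h.stronglyMeasurable_gradient hf hL hk).mono (𝓕.le k)).aestronglyMeasurable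
    Γ (ae_of_all _ (hΓ k hk))

theorem HeavyTailedNoise.predictableNoise (h : HeavyTailedNoise μ 𝓕 f α σ₀ σ₁ K G X)
    (hα1 : 1 < α) (hα2 : α ≤ 2) (hσ₀ : 0 ≤ σ₀) (hσ₁ : 0 ≤ σ₁) (hB : 0 < B)
    (hf : LSmooth f L) (hL : 0 ≤ L) (hΓ : ∀ k < K, ∀ ω, ‖∇ f (X k ω)‖ ≤ Γ) :
    PredictableNoise μ 𝓕 α (batchFactor α B * σ₀) (batchFactor α B * σ₁) Γ K
      (fun k ω => batchGrad G k ω - ∇ f (X k ω)) (fun k ω => ‖∇ f (X k ω)‖) := by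
  have hα0 : 0 < α := by linarith
  have hB' : (0 : ℝ) < B := by exact_mod_cast hB
  have hgm : ∀ k < K, StronglyMeasurable[𝓕 k] fun ω => ∇ f (X k ω) :=
    fun k hk => h.stronglyMeasurable_gradient hf hL hk
  have hgi : ∀ k < K, Integrable (fun ω => ∇ f (X k ω)) μ :=
    fun k hk => h.integrable_gradient hf hL hΓ hk
  have hvm : ∀ k < K, StronglyMeasurable[𝓕 k] fun ω => σ₀ ^ α + σ₁ ^ α * ‖∇ f (X k ω)‖ ^ α :=
    fun k hk => stronglyMeasurable_const.add
      (((Real.continuous_rpow_const hα0.le).comp_stronglyMeasurable (hgm k hk).norm).const_mul _)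
  have hvi : ∀ k < K, Integrable (fun ω => σ₀ ^ α + σ₁ ^ α * ‖∇ f (X k ω)‖ ^ α) μ := by
    intro k hk
    refine Integrable.of_bound ((hvm k hk).mono (𝓕.le k)).aestronglyMeasurable
      (σ₀ ^ α + σ₁ ^ α * Γ ^ α) (ae_of_all _ fun ω => ?_)
    rw [Real.norm_of_nonneg (by positivity)]
    gcongr
    exact hΓ k hk ω
  have key := fun k (hk : k < K) => (h.condIndep k hk).condExp_norm_batch_rpow_le hB hα1.le hα2
    (𝓕.le k) (fun i => ((h.adapted_G k hk i).mono (𝓕.le (k + 1))).measurable)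
    (h.integrable k hk) (hgm k hk) (h.unbiased k hk) (h.integrable_moment k hk) (hvm k hk)
    (hvi k hk) (h.moment_le k hk)
  refine ⟨fun k hk => ?_, fun k hk => (key k hk).1, fun k hk => ?_, fun k hk => (hgm k hk).norm,
    fun _ _ => norm_nonneg _, hΓ, fun k hk => ?_⟩
  · have hs : StronglyMeasurable[𝓕 (k + 1)] fun ω => ∑ i, G k i ω :=
      Finset.stronglyMeasurable_fun_sum _ fun i _ => h.adapted_G k hk i
    exact (hs.const_smul (B : ℝ)⁻¹).sub ((hgm k hk).mono (𝓕.mono (Nat.le_succ k)))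
  · have hs : Integrable (∑ i, G k i) μ := integrable_finsetSum' _ fun i _ => h.integrable k hk i
    have heq : (fun ω => batchGrad G k ω - ∇ f (X k ω))
        = (B : ℝ)⁻¹ • ∑ i, G k i - fun ω => ∇ f (X k ω) := by
      ext1 ω; simp [batchGrad]
    rw [heq]
    filter_upwards [condExp_sub (hs.smul (B : ℝ)⁻¹) (hgi k hk) (𝓕 k),
      condExp_smul (μ := μ) (B : ℝ)⁻¹ (∑ i, G k i) (𝓕 k),
      condExp_finsetSum (s := Finset.univ) (fun i _ => h.integrable k hk i) (𝓕 k),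
      ae_all_iff.2 (h.unbiased k hk)] with ω h1 h2 h3 h4
    rw [h1, Pi.sub_apply, h2, Pi.smul_apply, h3, Finset.sum_apply,
      condExp_of_stronglyMeasurable (𝓕.le k) (hgm k hk) (hgi k hk)]
    simp only [h4, Finset.sum_const, Finset.card_univ, Fintype.card_fin, Pi.zero_apply]
    rw [← Nat.cast_smul_eq_nsmul ℝ, inv_smul_smul₀ hB'.ne', sub_self]
  · filter_upwards [(key k hk).2] with ω h1
    refine h1.trans ?_
    have h2 := Real.add_rpow_le_rpow_add hσ₀ (mul_nonneg hσ₁ (norm_nonneg (∇ f (X k ω)))) hα1.le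
    rw [Real.mul_rpow hσ₁ (norm_nonneg _)] at h2
    have h3 : batchFactor α B ^ α = 2 * (B : ℝ) ^ (1 - α) := by
      rw [batchFactor, ← Real.rpow_mul (by positivity), one_div_mul_cancel hα0.ne', Real.rpow_one]
    rw [mul_assoc (batchFactor α B), ← mul_add,
      Real.mul_rpow (batchFactor_nonneg α B) (by positivity), h3]
    gcongr

end Noise

/-! ### The expected momentum error -/

/-- Summation of the bound on the expected momentum error over `k < K`, where `A k` stands for the
expected norm of the discounted noise, `s` for the expected initial error, `D` for the drift and
`ν` for the expected norm of the first noise term. -/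
lemma sum_error_majorant_le {β V b s D ν ν' : ℝ} {K : ℕ} {A γ : ℕ → ℝ} (hβ0 : 0 ≤ β)
    (hβ1 : β < 1) (hV : 0 ≤ V) (hb : 0 ≤ b) (hs : 0 ≤ s) (hν : 0 ≤ ν) (hν' : ν ≤ ν')
    (hγ : ∀ k, 0 ≤ γ k) (hA : ∀ k ≤ K, A k ≤ V + b * discountedSum β γ k) :
    ∑ k ∈ Finset.range K, (β ^ k * s + D + ((1 - β) * (1 + β) * A (k + 1) + (1 - β) * β * A k
      + β ^ k * ((1 - β) * (1 + β) * ν)))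
      ≤ s / (1 - β) + K * D + 3 * (1 - β) * (K * V) + 3 * b * ∑ k ∈ Finset.range K, γ k
        + 2 * ν' := by
  have hq : 0 < 1 - β := by linarith
  have hgeom : ∑ k ∈ Finset.range K, β ^ k ≤ 1 / (1 - β) := by
    rw [le_div_iff₀ hq, geom_sum_mul_neg]
    linarith [pow_nonneg hβ0 K]
  have hD1 := sum_discountedSum_le hβ0 hβ1 hγ K
  have hD0 : ∑ k ∈ Finset.range K, discountedSum β γ k
      ≤ (∑ k ∈ Finset.range K, γ k) / (1 - β) := by
    have h1 := Finset.sum_range_succ (fun k => discountedSum β γ k) K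
    rw [Finset.sum_range_succ', discountedSum_zero, add_zero] at h1
    have h2 : 0 ≤ discountedSum β γ K :=
      Finset.sum_nonneg fun j _ => mul_nonneg (pow_nonneg hβ0 _) (hγ j)
    linarith
  have hγs : 0 ≤ ∑ k ∈ Finset.range K, γ k := Finset.sum_nonneg fun k _ => hγ k
  set Γ := ∑ k ∈ Finset.range K, γ k
  have hA1 : ∑ k ∈ Finset.range K, A (k + 1) ≤ K * V + b * (Γ / (1 - β)) := by
    refine (Finset.sum_le_sum fun k hk => hA (k + 1) (Finset.mem_range.1 hk)).trans ?_
    rw [Finset.sum_add_distrib, ← Finset.mul_sum, Finset.sum_const, Finset.card_range,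
      nsmul_eq_mul]
    gcongr
  have hA0 : ∑ k ∈ Finset.range K, A k ≤ K * V + b * (Γ / (1 - β)) := by
    refine (Finset.sum_le_sum fun k hk => hA k (Finset.mem_range.1 hk).le).trans ?_
    rw [Finset.sum_add_distrib, ← Finset.mul_sum, Finset.sum_const, Finset.card_range,
      nsmul_eq_mul]
    gcongr
  simp only [Finset.sum_add_distrib, ← Finset.mul_sum, ← Finset.sum_mul, Finset.sum_const,
    Finset.card_range, nsmul_eq_mul]
  have e1 := mul_le_mul_of_nonneg_right hgeom hs
  have e2 := mul_le_mul_of_nonneg_right hgeom (show 0 ≤ (1 - β) * (1 + β) * ν by positivity)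
  have e3 := mul_le_mul_of_nonneg_left hA1 (show 0 ≤ (1 - β) * (1 + β) by positivity)
  have e4 := mul_le_mul_of_nonneg_left hA0 (show 0 ≤ (1 - β) * β by positivity)
  have e5 : 1 / (1 - β) * ((1 - β) * (1 + β) * ν) = (1 + β) * ν := by field_simp
  have e6 : (1 + β) * ν ≤ 2 * ν' := mul_le_mul (by linarith) hν' hν (by norm_num)
  have e7 : (1 - β) * (1 + β) * (K * V + b * (Γ / (1 - β)))
      + (1 - β) * β * (K * V + b * (Γ / (1 - β)))
      = (1 + 2 * β) * ((1 - β) * (K * V) + b * Γ) := by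
    field_simp; ring
  have e8 : (1 + 2 * β) * ((1 - β) * (K * V) + b * Γ) ≤ 3 * ((1 - β) * (K * V) + b * Γ) :=
    mul_le_mul_of_nonneg_right (by linarith) (by positivity)
  have e9 : 1 / (1 - β) * s = s / (1 - β) := by ring
  linarith

section MomentumError

variable {m n B : ℕ} {Ω : Type*} {f : Mat m n → ℝ} {L η β : ℝ} {K : ℕ} {X₀ Cinit : Mat m n}
  {G : ℕ → Fin B → Ω → Mat m n} {C M X : ℕ → Ω → Mat m n}

/-- The momentum error at step `k` in terms of the initial error, the drift of the iterates and the
noise. -/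
lemma IsMuonRun.norm_momentum_error_le (h : IsMuonRun K η β X₀ Cinit G C M X) (hη : 0 ≤ η)
    (hβ0 : 0 ≤ β) (hβ1 : β < 1) (hf : LSmooth f L) (hL : 0 ≤ L) (ω : Ω) {k : ℕ} (hk : k < K) :
    ‖(1 - β) • M k ω - ∇ f (X k ω)‖ ≤ β ^ k * ‖(1 - β) • M 0 ω - ∇ f (X 0 ω)‖
      + L * (η * √((min m n : ℕ) : ℝ)) / (1 - β)
      + ((1 - β) * (1 + β) *
          ‖discountedSum β (fun j => batchGrad G j ω - ∇ f (X j ω)) (k + 1)‖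
        + (1 - β) * β * ‖discountedSum β (fun j => batchGrad G j ω - ∇ f (X j ω)) k‖
        + β ^ k * ((1 - β) * (1 + β) * ‖batchGrad G 0 ω - ∇ f (X 0 ω)‖)) := by
  have hq : 0 ≤ 1 - β := by linarith
  rw [h.momentum_error_eq f ω hk]
  refine (norm_add_le _ _).trans (add_le_add ((norm_add_le _ _).trans (add_le_add ?_ ?_)) ?_)
  · rw [norm_smul, Real.norm_of_nonneg (pow_nonneg hβ0 k)]
  · rw [norm_smul, Real.norm_of_nonneg (sq_nonneg β)]
    have hd : ∀ j < k, ‖∇ f (X j ω) - ∇ f (X (j + 1) ω)‖ ≤ L * (η * √((min m n : ℕ) : ℝ)) := by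
      intro j hj
      refine (hf.2 _ _).trans (mul_le_mul_of_nonneg_left ?_ hL)
      rw [norm_sub_rev]
      exact h.norm_step_le hη (hj.trans hk) ω
    refine (mul_le_of_le_one_left (norm_nonneg _) (pow_le_one₀ hβ0 hβ1.le)).trans ?_
    exact norm_discountedSum_le hβ0 hβ1 hd (by positivity)
  · rw [norm_smul, Real.norm_of_nonneg hq]
    have h1 := (norm_sub_le ((1 + β) •
        discountedSum β (fun j => batchGrad G j ω - ∇ f (X j ω)) (k + 1)
      - β • discountedSum β (fun j => batchGrad G j ω - ∇ f (X j ω)) k)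
      (((1 + β) * β ^ k) • (batchGrad G 0 ω - ∇ f (X 0 ω)))).trans
      (add_le_add_left (norm_sub_le _ _) _)
    rw [norm_smul, norm_smul, norm_smul, Real.norm_of_nonneg hβ0,
      Real.norm_of_nonneg (show 0 ≤ 1 + β by linarith),
      Real.norm_of_nonneg (show 0 ≤ (1 + β) * β ^ k by positivity)] at h1
    refine (mul_le_mul_of_nonneg_left h1 hq).trans_eq ?_
    ring

lemma IsMuonRun.initial_error_eq (h : IsMuonRun K η β X₀ Cinit G C M X) (hK : 0 < K) (ω : Ω) :
    (1 - β) • M 0 ω - ∇ f (X 0 ω) = ((1 - β) * β ^ 2) • Cinit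
      + (1 - β ^ 2) • (batchGrad G 0 ω - ∇ f (X 0 ω)) - β ^ 2 • ∇ f X₀ := by
  rw [h.M_eq 0 hK, h.C_zero, h.X_zero]
  module

variable {mΩ : MeasurableSpace Ω} {μ : Measure Ω} [IsProbabilityMeasure μ] {𝓕 : Filtration ℕ mΩ}
  {α Γ : ℝ}

lemma IsMuonRun.integrable_initial_error (h : IsMuonRun K η β X₀ Cinit G C M X) (hK : 0 < K)
    (hN : Integrable (fun ω => batchGrad G 0 ω - ∇ f (X 0 ω)) μ) :
    Integrable (fun ω => (1 - β) • M 0 ω - ∇ f (X 0 ω)) μ := by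
  simp only [h.initial_error_eq hK]
  have h1 : Integrable (fun ω => (1 - β ^ 2) • (batchGrad G 0 ω - ∇ f (X 0 ω))) μ :=
    hN.smul (1 - β ^ 2)
  exact ((integrable_const (((1 - β) * β ^ 2) • Cinit)).add h1).sub
    (integrable_const (β ^ 2 • ∇ f X₀))

lemma IsMuonRun.integral_norm_initial_error_le (h : IsMuonRun K η β X₀ Cinit G C M X) (hK : 0 < K)
    (hβ0 : 0 ≤ β) (hβ1 : β < 1) (hN : Integrable (fun ω => batchGrad G 0 ω - ∇ f (X 0 ω)) μ) :
    ∫ ω, ‖(1 - β) • M 0 ω - ∇ f (X 0 ω)‖ ∂μ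
      ≤ ‖Cinit‖ + ∫ ω, ‖batchGrad G 0 ω - ∇ f (X 0 ω)‖ ∂μ + ‖∇ f X₀‖ := by
  have hb2 : β ^ 2 ≤ 1 := pow_le_one₀ hβ0 hβ1.le
  have hq : 0 ≤ 1 - β := by linarith
  have hi : Integrable (fun ω => ‖Cinit‖ + ‖batchGrad G 0 ω - ∇ f (X 0 ω)‖ + ‖∇ f X₀‖) μ :=
    ((integrable_const _).add hN.norm).add (integrable_const _)
  refine (integral_mono (h.integrable_initial_error hK hN).norm hi fun ω => ?_).trans_eq ?_
  · simp only [h.initial_error_eq hK]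
    refine (norm_sub_le _ _).trans (add_le_add ((norm_add_le _ _).trans (add_le_add ?_ ?_)) ?_)
    · rw [norm_smul, Real.norm_of_nonneg (by positivity)]
      have h1 : (1 - β) * β ^ 2 ≤ 1 * 1 :=
        mul_le_mul (by linarith) hb2 (sq_nonneg β) zero_le_one
      exact mul_le_of_le_one_left (norm_nonneg _) (h1.trans_eq (one_mul 1))
    · rw [norm_smul, Real.norm_of_nonneg (by linarith)]
      exact mul_le_of_le_one_left (norm_nonneg _) (by linarith [sq_nonneg β])
    · rw [norm_smul, Real.norm_of_nonneg (by positivity)]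
      exact mul_le_of_le_one_left (norm_nonneg _) hb2
  · have hi' : Integrable (fun ω => ‖Cinit‖ + ‖batchGrad G 0 ω - ∇ f (X 0 ω)‖) μ :=
      (integrable_const _).add hN.norm
    rw [integral_add hi' (integrable_const _), integral_add (integrable_const _) hN.norm]
    simp

/-- Sum of the descent inequality over a run, in expectation. With weights bounded by
`(1 - β) (1 + 2 β) / (1 - β) ≤ 3`, the gradient-dependent part of the noise enters with the
coefficient `3 b`. -/
theorem IsMuonRun.sum_integral_norm_gradient_le (h : IsMuonRun K η β X₀ Cinit G C M X)
    (hK : 0 < K) (hη : 0 ≤ η) (hβ0 : 0 ≤ β) (hβ1 : β < 1) (hf : LSmooth f L) (hL : 0 ≤ L)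
    {fstar a b : ℝ} (hfb : ∀ Y, fstar ≤ f Y) (ha : 0 ≤ a) (hb : 0 ≤ b) (hα1 : 1 ≤ α) (hα2 : α ≤ 2)
    (hN : PredictableNoise μ 𝓕 α a b Γ K (fun k ω => batchGrad G k ω - ∇ f (X k ω))
      (fun k ω => ‖∇ f (X k ω)‖)) :
    η * ∑ k ∈ Finset.range K, ∫ ω, ‖∇ f (X k ω)‖ ∂μ ≤ f X₀ - fstar
      + η * ((1 + √((min m n : ℕ) : ℝ)) *
        ((∫ ω, ‖(1 - β) • M 0 ω - ∇ f (X 0 ω)‖ ∂μ) / (1 - β)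
          + K * (L * (η * √((min m n : ℕ) : ℝ)) / (1 - β))
          + 3 * (1 - β) * (K * (2 * (a ^ α / (1 - β))) ^ (1 / α))
          + 3 * b * ∑ k ∈ Finset.range K, ∫ ω, ‖∇ f (X k ω)‖ ∂μ
          + 2 * (a + b * ‖∇ f X₀‖)))
      + K * (L * η ^ 2 * (min m n : ℕ)) := by
  have hq : 0 < 1 - β := by linarith
  set d : ℝ := √((min m n : ℕ) : ℝ)
  set A : ℕ → Ω → Mat m n := fun k ω =>
    discountedSum β (fun j => batchGrad G j ω - ∇ f (X j ω)) k with hA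
  set S : Ω → ℝ := fun ω => ‖(1 - β) • M 0 ω - ∇ f (X 0 ω)‖ with hS
  set N₀ : Ω → ℝ := fun ω => ‖batchGrad G 0 ω - ∇ f (X 0 ω)‖ with hN₀
  set γ : ℕ → ℝ := fun k => ∫ ω, ‖∇ f (X k ω)‖ ∂μ with hγ
  set V : ℝ := (2 * (a ^ α / (1 - β))) ^ (1 / α) with hV
  have hV0 : 0 ≤ V := by positivity
  have hγ0 : ∀ k, 0 ≤ γ k := fun k => integral_nonneg fun _ => norm_nonneg _
  have iA : ∀ k ≤ K, Integrable (fun ω => ‖A k ω‖) μ := fun k hk =>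
    (integrable_finsetSum _ fun j hj => (hN.integrable hα1
      ((Finset.mem_range.1 hj).trans_le hk)).smul (β ^ (k - 1 - j))).norm
  have iN₀ : Integrable N₀ μ := (hN.integrable hα1 hK).norm
  have iS : Integrable S μ := (h.integrable_initial_error hK (hN.integrable hα1 hK)).norm
  -- A pointwise majorant of the momentum error, and its expectation.
  set U : ℕ → Ω → ℝ := fun k ω => β ^ k * S ω + L * (η * d) / (1 - β)
    + ((1 - β) * (1 + β) * ‖A (k + 1) ω‖ + (1 - β) * β * ‖A k ω‖
      + β ^ k * ((1 - β) * (1 + β) * N₀ ω)) with hU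
  have iU : ∀ k < K, Integrable (U k) μ := fun k hk =>
    ((iS.const_mul _).add (integrable_const _)).add
      ((((iA (k + 1) hk).const_mul _).add ((iA k hk.le).const_mul _)).add
        ((iN₀.const_mul _).const_mul _))
  have hUint : ∀ k < K, ∫ ω, U k ω ∂μ = β ^ k * ∫ ω, S ω ∂μ + L * (η * d) / (1 - β)
      + ((1 - β) * (1 + β) * ∫ ω, ‖A (k + 1) ω‖ ∂μ + (1 - β) * β * ∫ ω, ‖A k ω‖ ∂μ
        + β ^ k * ((1 - β) * (1 + β) * ∫ ω, N₀ ω ∂μ)) := by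
    intro k hk
    have i1 : Integrable (fun ω => β ^ k * S ω) μ := iS.const_mul _
    have i2 : Integrable (fun ω => β ^ k * S ω + L * (η * d) / (1 - β)) μ :=
      i1.add (integrable_const _)
    have i3 : Integrable (fun ω => (1 - β) * (1 + β) * ‖A (k + 1) ω‖) μ :=
      (iA (k + 1) hk).const_mul _
    have i4 : Integrable (fun ω => (1 - β) * β * ‖A k ω‖) μ := (iA k hk.le).const_mul _
    have i5 : Integrable (fun ω => (1 - β) * (1 + β) * ‖A (k + 1) ω‖ + (1 - β) * β * ‖A k ω‖) μ :=
      i3.add i4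
    have i6 : Integrable (fun ω => β ^ k * ((1 - β) * (1 + β) * N₀ ω)) μ :=
      (iN₀.const_mul _).const_mul _
    have i7 : Integrable (fun ω => (1 - β) * (1 + β) * ‖A (k + 1) ω‖ + (1 - β) * β * ‖A k ω‖
      + β ^ k * ((1 - β) * (1 + β) * N₀ ω)) μ := i5.add i6
    simp only [hU]
    rw [integral_add i2 i7, integral_add i1 (integrable_const _), integral_add i5 i6,
      integral_add i3 i4]
    simp only [integral_const_mul, integral_const, probReal_univ, one_smul]
  have hN0 : ∫ ω, N₀ ω ∂μ ≤ a + b * ‖∇ f X₀‖ := by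
    have := hN.integral_norm_le hα1 ha hb hK
    simp only [h.X_zero, integral_const, probReal_univ, one_smul] at this
    simpa only [hN₀, h.X_zero] using this
  have hUsum : ∑ k ∈ Finset.range K, ∫ ω, U k ω ∂μ ≤ (∫ ω, S ω ∂μ) / (1 - β)
      + K * (L * (η * d) / (1 - β)) + 3 * (1 - β) * (K * V)
      + 3 * b * ∑ k ∈ Finset.range K, γ k + 2 * (a + b * ‖∇ f X₀‖) := by
    rw [Finset.sum_congr rfl fun k hk => hUint k (Finset.mem_range.1 hk)]
    exact sum_error_majorant_le hβ0 hβ1 hV0 hb (integral_nonneg fun _ => norm_nonneg _)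
      (integral_nonneg fun _ => norm_nonneg _) hN0 hγ0 fun k hk =>
        hN.integral_norm_discountedSum_le hα1 hα2 ha hb hβ0 hβ1 hk
  have hgi : ∀ k ∈ Finset.range K, Integrable (fun ω => ‖∇ f (X k ω)‖) μ := fun k hk =>
    hN.integrable_bound (Finset.mem_range.1 hk)
  have iUs : Integrable (fun ω => ∑ k ∈ Finset.range K, U k ω) μ :=
    integrable_finsetSum _ fun k hk => iU k (Finset.mem_range.1 hk)
  have hpt : ∀ ω, η * ∑ k ∈ Finset.range K, ‖∇ f (X k ω)‖
      ≤ η * (1 + d) * ∑ k ∈ Finset.range K, U k ω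
        + (f X₀ - fstar + K * (L * η ^ 2 * (min m n : ℕ))) := by
    intro ω
    have h1 := h.sum_norm_gradient_le hη hβ1.le hf hL hfb ω
    have h2 : ∑ k ∈ Finset.range K, ‖(1 - β) • M k ω - ∇ f (X k ω)‖
        ≤ ∑ k ∈ Finset.range K, U k ω := Finset.sum_le_sum fun k hk =>
      h.norm_momentum_error_le hη hβ0 hβ1 hf hL ω (Finset.mem_range.1 hk)
    have h3 := mul_le_mul_of_nonneg_left h2 (show 0 ≤ η * (1 + d) by positivity)
    linarith
  have hfin := integral_mono ((integrable_finsetSum _ hgi).const_mul η)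
    ((iUs.const_mul (η * (1 + d))).add (integrable_const _)) hpt
  simp only [Pi.add_apply] at hfin
  rw [integral_const_mul, integral_finsetSum _ hgi,
    integral_add (iUs.const_mul (η * (1 + d))) (integrable_const _), integral_const_mul,
    integral_finsetSum _ fun k hk => iU k (Finset.mem_range.1 hk), integral_const, probReal_univ,
    one_smul] at hfin
  have hfin' := mul_le_mul_of_nonneg_left hUsum (show 0 ≤ η * (1 + d) by positivity)
  linarith

end MomentumError

/-! ### The schedule and the rate -/

lemma weighted_terms_le {d t₁ t₂ t₃ t₄ t₅ t₆ u v w : ℝ} (hd : 0 ≤ d) (h₁ : 0 ≤ t₁) (h₂ : 0 ≤ t₂)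
    (h₃ : 0 ≤ t₃) (h₄ : 0 ≤ t₄) (h₅ : 0 ≤ t₅) (h₆ : 0 ≤ t₆) (hu : u ≤ 2 * t₃) (hv : v ≤ 2 * t₃)
    (hw : w ≤ 2 * t₆) :
    t₁ + (1 + d) * (t₅ + d * t₂ + 6 * u + 2 * v + 2 * w) + d ^ 2 * t₄
      ≤ 16 * (1 + d) ^ 2 * (t₁ + t₂ + t₃ + t₄ + t₅ + t₆) := by
  have h1 : 0 ≤ 1 + d := by linarith
  have key : 16 * (1 + d) ^ 2 * (t₁ + t₂ + t₃ + t₄ + t₅ + t₆)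
      - (t₁ + (1 + d) * (t₅ + d * t₂ + 16 * t₃ + 4 * t₆) + d ^ 2 * t₄)
      = (15 + 32 * d + 16 * d ^ 2) * t₁ + (16 + 31 * d + 15 * d ^ 2) * t₂
        + 16 * (d + d ^ 2) * t₃ + (16 + 32 * d + 15 * d ^ 2) * t₄
        + (15 + 31 * d + 16 * d ^ 2) * t₅ + (12 + 28 * d + 16 * d ^ 2) * t₆ := by ring
  have hpos : 0 ≤ (15 + 32 * d + 16 * d ^ 2) * t₁ + (16 + 31 * d + 15 * d ^ 2) * t₂
        + 16 * (d + d ^ 2) * t₃ + (16 + 32 * d + 15 * d ^ 2) * t₄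
        + (15 + 31 * d + 16 * d ^ 2) * t₅ + (12 + 28 * d + 16 * d ^ 2) * t₆ := by positivity
  have h2 : (1 + d) * (t₅ + d * t₂ + 6 * u + 2 * v + 2 * w)
      ≤ (1 + d) * (t₅ + d * t₂ + 16 * t₃ + 4 * t₆) :=
    mul_le_mul_of_nonneg_left (by linarith) h1
  linarith

/-- Division of the summed descent inequality by `ρ η K`. With `P = K ^ ((α - 1) / (3 α - 2))` and
`q = K ^ (-α / (3 α - 2))`, the schedule satisfies `η = q / P` and `K = P ^ 2 / q`. -/
lemma rate_of_sum_le {K P q η d a a' b b' Δ L s g Γ V ρ : ℝ} (hP : 1 ≤ P) (hq0 : 0 < q)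
    (hq1 : q ≤ 1) (hη : η = q / P) (hK : K = P ^ 2 / q) (hd : 0 ≤ d) (hΔ : 0 ≤ Δ) (hL : 0 ≤ L)
    (hs : 0 ≤ s) (hg : 0 ≤ g) (hΓ : 0 ≤ Γ) (ha : 0 ≤ a) (haa : a ≤ 2 * a') (hb : 0 ≤ b)
    (hbb : b ≤ 2 * b') (hρ0 : 0 < ρ) (hρ : 3 * (1 + d) * b ≤ 1 - ρ) (hV : q * V ≤ 2 * a / P)
    (h : η * Γ ≤ Δ + η * ((1 + d) * (s / q + K * (L * (η * d) / q) + 3 * q * (K * V)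
      + 3 * b * Γ + 2 * (a + b * g))) + K * (L * η ^ 2 * d ^ 2)) :
    Γ / K ≤ 16 * (1 + d) ^ 2 * (Δ / (ρ * P) + L / (ρ * P) + a' / (ρ * P) + L / (ρ * (P / q))
      + s / (ρ * P ^ 2) + b' * g / (ρ * K)) := by
  have hP0 : 0 < P := by linarith
  have hK0 : 0 < K := by rw [hK]; positivity
  have hKP : P ≤ K := by
    rw [hK, le_div_iff₀ hq0]
    nlinarith
  have hη0 : 0 < η := by rw [hη]; positivity
  have h1 : Γ ≤ Δ / η + (1 + d) * (s / q + K * (L * (η * d) / q) + 3 * q * (K * V)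
      + 3 * b * Γ + 2 * (a + b * g)) + K * (L * η * d ^ 2) := by
    refine le_of_mul_le_mul_left (h.trans_eq ?_) hη0
    field_simp
  have h2 : 3 * q * (K * V) ≤ 6 * K * (a / P) := by
    have := mul_le_mul_of_nonneg_left hV (show 0 ≤ 3 * K by positivity)
    calc 3 * q * (K * V) = 3 * K * (q * V) := by ring
      _ ≤ _ := this
      _ = _ := by ring
  have h3 : ρ * Γ ≤ Δ / η + (1 + d) * (s / q + K * (L * (η * d) / q) + 6 * K * (a / P)
      + 2 * (a + b * g)) + K * (L * η * d ^ 2) := by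
    have e1 := mul_le_mul_of_nonneg_left h2 (show 0 ≤ 1 + d by linarith)
    have e2 := mul_le_mul_of_nonneg_right hρ hΓ
    linarith
  have h4 : Γ / K ≤ (Δ / (ρ * P) + (1 + d) * (s / (ρ * P ^ 2) + d * (L / (ρ * P))
      + 6 * (a / (ρ * P)) + 2 * (a / (ρ * K)) + 2 * (b * g / (ρ * K)))
      + d ^ 2 * (L / (ρ * (P / q)))) := by
    rw [div_le_iff₀ hK0]
    refine le_of_mul_le_mul_left (h3.trans_eq ?_) hρ0
    rw [hη, hK]
    field_simp
    ring
  have h5 : a / (ρ * K) ≤ 2 * (a' / (ρ * P)) := by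
    rw [← mul_div_assoc]
    exact div_le_div₀ (by linarith) haa (by positivity) (by gcongr)
  have h6 : a / (ρ * P) ≤ 2 * (a' / (ρ * P)) := by
    rw [← mul_div_assoc]
    gcongr
  have h7 : b * g / (ρ * K) ≤ 2 * (b' * g / (ρ * K)) := by
    rw [← mul_div_assoc, ← mul_assoc]
    gcongr
  have ha' : 0 ≤ a' := by linarith
  have hb' : 0 ≤ b' := by linarith
  exact h4.trans (weighted_terms_le hd (by positivity) (by positivity) (by positivity)
    (by positivity) (by positivity) (by positivity) h6 h5 h7)

/-- The factor `(1 - β) V` of the noise accumulated over the momentum window is of order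
`a (1 - β) ^ ((α - 1) / α)`. -/
lemma mul_rpow_accumulated_noise_le {α a q : ℝ} (hα : 1 ≤ α) (ha : 0 ≤ a) (hq : 0 < q) :
    q * (2 * (a ^ α / q)) ^ (1 / α) ≤ 2 * a * q ^ ((α - 1) / α) := by
  have hα0 : 0 < α := by linarith
  rw [Real.mul_rpow (by norm_num) (by positivity), Real.div_rpow (by positivity) hq.le,
    ← Real.rpow_mul ha, mul_one_div_cancel hα0.ne', Real.rpow_one, sub_div, div_self hα0.ne',
    Real.rpow_sub hq, Real.rpow_one]
  have h2 : (2 : ℝ) ^ (1 / α) ≤ 2 :=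
    Real.rpow_le_self_of_one_le (by norm_num) ((div_le_one hα0).2 hα)
  calc q * (2 ^ (1 / α) * (a / q ^ (1 / α))) = 2 ^ (1 / α) * (a * (q / q ^ (1 / α))) := by ring
    _ ≤ 2 * (a * (q / q ^ (1 / α))) := by gcongr
    _ = 2 * a * (q / q ^ (1 / α)) := by ring

lemma batch_pos_of_threshold_lt {α Cα σ₁ : ℝ} {d₀ B : ℕ} (hC : 0 ≤ Cα) (hσ₁ : 0 ≤ σ₁)
    (h : batchThreshold α Cα d₀ σ₁ < (B : ℝ)) : 0 < B := by
  have h0 : 0 ≤ batchThreshold α Cα d₀ σ₁ := by unfold batchThreshold; positivity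
  exact_mod_cast h0.trans_lt h

lemma rhoEx_pos {α Cα σ₁ : ℝ} {d₀ B : ℕ} (hα : 1 < α) (hC : 0 ≤ Cα) (hσ₁ : 0 ≤ σ₁)
    (h : batchThreshold α Cα d₀ σ₁ < (B : ℝ)) : 0 < rhoEx α Cα d₀ σ₁ B := by
  have hB : (0 : ℝ) < B := by exact_mod_cast batch_pos_of_threshold_lt hC hσ₁ h
  have hα0 : 0 < α := by linarith
  have hα' : 0 < α - 1 := by linarith
  have hT : 0 ≤ 2 * √Real.pi * (1 + √(d₀ : ℝ)) * Cα ^ (1 / α) * σ₁ := by positivity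
  have h1 := Real.rpow_lt_rpow (Real.rpow_nonneg hT _) h
    (show 0 < (α - 1) / α by positivity)
  rw [← Real.rpow_mul hT, div_mul_div_cancel₀ hα'.ne', div_self hα0.ne', Real.rpow_one] at h1
  rw [rhoEx, sub_pos, div_lt_one (by positivity)]
  linarith

/-- The coefficient `3` of the gradient-dependent noise is below the constant `2 √π` of the
batch-size threshold. -/
lemma three_mul_batchFactor_le {α σ₁ : ℝ} {d₀ B : ℕ} (hσ₁ : 0 ≤ σ₁) (hB : 0 < B) :
    3 * (1 + √(d₀ : ℝ)) * (batchFactor α B * σ₁) ≤ 1 - rhoEx α 2 d₀ σ₁ B := by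
  have hπ : (3 : ℝ) ≤ 2 * √Real.pi := by
    have : (3 / 2 : ℝ) ≤ √Real.pi := Real.le_sqrt_of_sq_le (by linarith [Real.pi_gt_three])
    linarith
  rw [batchFactor_eq α hB, rhoEx, sub_sub_cancel]
  calc 3 * (1 + √(d₀ : ℝ)) * (2 ^ (1 / α) / (B : ℝ) ^ ((α - 1) / α) * σ₁)
      = 3 * ((1 + √(d₀ : ℝ)) * 2 ^ (1 / α) * σ₁ / (B : ℝ) ^ ((α - 1) / α)) := by ring
    _ ≤ 2 * √Real.pi * ((1 + √(d₀ : ℝ)) * 2 ^ (1 / α) * σ₁ / (B : ℝ) ^ ((α - 1) / α)) := by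
        gcongr
    _ = _ := by ring

section Schedule

variable {α : ℝ} {K : ℕ}

lemma one_sub_momentum : 1 - momentum α K = 1 / (K : ℝ) ^ (α / (3 * α - 2)) := by
  rw [momentum, sub_sub_cancel]

lemma momentum_nonneg (hα : 1 < α) (hK : 1 ≤ K) : 0 ≤ momentum α K := by
  have hK' : (1 : ℝ) ≤ K := by exact_mod_cast hK
  rw [momentum, sub_nonneg]
  exact div_le_one_of_le₀ (Real.one_le_rpow hK' (div_nonneg (by linarith) (by linarith)))
    (by positivity)

lemma momentum_lt_one (hK : 1 ≤ K) : momentum α K < 1 := by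
  have hK' : (0 : ℝ) < K := by exact_mod_cast hK
  have : 0 < 1 / (K : ℝ) ^ (α / (3 * α - 2)) := by positivity
  rw [momentum]
  linarith

end Schedule

/-- Finiteness of the expectations and the explicit bound, for a single run. -/
theorem IsMuonRun.exists_integral_norm_gradient_le {m n B : ℕ} {Ω : Type*}
    {mΩ : MeasurableSpace Ω} {μ : Measure Ω} [IsProbabilityMeasure μ] {𝓕 : Filtration ℕ mΩ}
    {f : Mat m n → ℝ} {α σ₀ σ₁ L fstar : ℝ} {K : ℕ} {X₀ Cinit : Mat m n}
    {G : ℕ → Fin B → Ω → Mat m n} {C M X : ℕ → Ω → Mat m n}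
    (h : IsMuonRun K (stepSize α K) (momentum α K) X₀ Cinit G C M X)
    (hnoise : HeavyTailedNoise μ 𝓕 f α σ₀ σ₁ K G X) (hα1 : 1 < α) (hα2 : α ≤ 2)
    (hσ₀ : 0 ≤ σ₀) (hσ₁ : 0 ≤ σ₁) (hf : LSmooth f L) (hL : 0 ≤ L) (hfb : ∀ Y, fstar ≤ f Y)
    (hB : batchThreshold α 2 (min m n) σ₁ < (B : ℝ)) (hK : 2 ≤ K) :
    (∀ k < K, Integrable (fun ω => ∇ f (X k ω)) μ) ∧
    Integrable (fun ω => (1 - momentum α K) • M 0 ω - ∇ f (X 0 ω)) μ ∧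
    ∫ ω, ‖(1 - momentum α K) • M 0 ω - ∇ f (X 0 ω)‖ ∂μ ≤ ‖Cinit‖
      + 2 * (σ₀ / (B : ℝ) ^ ((α - 1) / α) + σ₁ * ‖∇ f X₀‖ / (B : ℝ) ^ ((α - 1) / α))
      + ‖∇ f X₀‖ ∧
    ∃ k < K, ∫ ω, ‖∇ f (X k ω)‖ ∂μ ≤ 16 * (1 + √((min m n : ℕ) : ℝ)) ^ 2 *
      ((f X₀ - fstar) / (rhoEx α 2 (min m n) σ₁ B * (K : ℝ) ^ ((α - 1) / (3 * α - 2)))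
        + L / (rhoEx α 2 (min m n) σ₁ B * (K : ℝ) ^ ((α - 1) / (3 * α - 2)))
        + σ₀ / (rhoEx α 2 (min m n) σ₁ B * (B : ℝ) ^ ((α - 1) / α)
            * (K : ℝ) ^ ((α - 1) / (3 * α - 2)))
        + L / (rhoEx α 2 (min m n) σ₁ B * (K : ℝ) ^ ((2 * α - 1) / (3 * α - 2)))
        + (∫ ω, ‖(1 - momentum α K) • M 0 ω - ∇ f (X 0 ω)‖ ∂μ)
            / (rhoEx α 2 (min m n) σ₁ B * (K : ℝ) ^ ((2 * α - 2) / (3 * α - 2)))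
        + σ₁ * ‖∇ f X₀‖ / (rhoEx α 2 (min m n) σ₁ B * (B : ℝ) ^ ((α - 1) / α) * (K : ℝ))) := by
  have hKpos : 0 < K := by omega
  have hK1 : (1 : ℝ) ≤ K := by exact_mod_cast hKpos
  have hK0 : (0 : ℝ) < K := by linarith
  have hBpos := batch_pos_of_threshold_lt zero_le_two hσ₁ hB
  have hB' : (0 : ℝ) < B := by exact_mod_cast hBpos
  have hρ := rhoEx_pos hα1 zero_le_two hσ₁ hB
  have hη : 0 ≤ stepSize α K := by unfold stepSize; positivity
  have hβ0 : 0 ≤ momentum α K := momentum_nonneg hα1 hKpos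
  have hβ1 : momentum α K < 1 := momentum_lt_one hKpos
  have hΓ := fun k (hk : k < K) ω => h.norm_gradient_le hη hf hL hk ω
  have hN := hnoise.predictableNoise hα1 hα2 hσ₀ hσ₁ hBpos hf hL hΓ
  have hc0 := batchFactor_nonneg α B
  have hcle := batchFactor_le hα1 hBpos
  set W : ℝ := (B : ℝ) ^ ((α - 1) / α) with hW
  have hW0 : 0 < W := by positivity
  have ha : 0 ≤ batchFactor α B * σ₀ := mul_nonneg hc0 hσ₀
  have hb : 0 ≤ batchFactor α B * σ₁ := mul_nonneg hc0 hσ₁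
  have haa : batchFactor α B * σ₀ ≤ 2 * (σ₀ / W) :=
    (mul_le_mul_of_nonneg_right hcle hσ₀).trans_eq (by ring)
  have hbb : batchFactor α B * σ₁ ≤ 2 * (σ₁ / W) :=
    (mul_le_mul_of_nonneg_right hcle hσ₁).trans_eq (by ring)
  refine ⟨fun k hk => hnoise.integrable_gradient hf hL hΓ hk,
    h.integrable_initial_error hKpos (hN.integrable hα1.le hKpos), ?_, ?_⟩
  · have h1 := h.integral_norm_initial_error_le hKpos hβ0 hβ1 (hN.integrable hα1.le hKpos)
    have h2 := hN.integral_norm_le hα1.le ha hb hKpos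
    simp only [h.X_zero, integral_const, probReal_univ, one_smul] at h1 h2 ⊢
    have h3 := mul_le_mul_of_nonneg_right hbb (norm_nonneg (∇ f X₀))
    have h4 : 2 * (σ₁ / W) * ‖∇ f X₀‖ = 2 * (σ₁ * ‖∇ f X₀‖ / W) := by ring
    linarith
  · have hsum := h.sum_integral_norm_gradient_le hKpos hη hβ0 hβ1 hf hL hfb ha hb hα1.le hα2 hN
    have hden : 0 < 3 * α - 2 := by linarith
    set P : ℝ := (K : ℝ) ^ ((α - 1) / (3 * α - 2)) with hPdef
    have hP1 : 1 ≤ P := Real.one_le_rpow hK1 (div_nonneg (by linarith) hden.le)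
    have hP0 : 0 < P := by linarith
    set q : ℝ := 1 - momentum α K with hq
    have hq0 : 0 < q := by linarith
    have hqdef : q = 1 / (K : ℝ) ^ (α / (3 * α - 2)) := one_sub_momentum
    have hQ0 : 0 < (K : ℝ) ^ (α / (3 * α - 2)) := by positivity
    have hP2 : (K : ℝ) ^ ((2 * α - 2) / (3 * α - 2)) = P ^ 2 := by
      rw [hPdef, ← Real.rpow_natCast, ← Real.rpow_mul hK0.le]
      congr 1; push_cast; ring
    have hH : (K : ℝ) ^ ((2 * α - 1) / (3 * α - 2)) = P / q := by
      rw [hqdef, hPdef, div_div_eq_mul_div, div_one, ← Real.rpow_add hK0]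
      congr 1; ring
    have hKeq : (K : ℝ) = P ^ 2 / q := by
      rw [hqdef, ← hP2, div_div_eq_mul_div, div_one, ← Real.rpow_add hK0, ← add_div]
      rw [show 2 * α - 2 + α = 3 * α - 2 by ring, div_self hden.ne', Real.rpow_one]
    have hηeq : stepSize α K = q / P := by
      rw [stepSize, hH, one_div_div]
    have hqP : q ^ ((α - 1) / α) = 1 / P := by
      rw [hqdef, Real.div_rpow zero_le_one hQ0.le, Real.one_rpow, ← Real.rpow_mul hK0.le]
      congr 2
      field_simp
    have hV : q * (2 * ((batchFactor α B * σ₀) ^ α / q)) ^ (1 / α)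
        ≤ 2 * (batchFactor α B * σ₀) / P := by
      refine (mul_rpow_accumulated_noise_le hα1.le ha hq0).trans_eq ?_
      rw [hqP, mul_one_div]
    have hd2 : ((min m n : ℕ) : ℝ) = √((min m n : ℕ) : ℝ) ^ 2 :=
      (Real.sq_sqrt (Nat.cast_nonneg _)).symm
    have hΓ0 : 0 ≤ ∑ k ∈ Finset.range K, ∫ ω, ‖∇ f (X k ω)‖ ∂μ :=
      Finset.sum_nonneg fun _ _ => integral_nonneg fun _ => norm_nonneg _
    rw [← Real.sq_sqrt (Nat.cast_nonneg (min m n) : (0 : ℝ) ≤ ((min m n : ℕ) : ℝ)),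
      Real.sqrt_sq (Real.sqrt_nonneg _)] at hsum
    have hrate := rate_of_sum_le hP1 hq0 (by linarith) hηeq hKeq (Real.sqrt_nonneg _)
      (sub_nonneg.2 (hfb X₀)) hL (integral_nonneg fun _ => norm_nonneg _) (norm_nonneg _) hΓ0 ha haa
      hb hbb hρ (three_mul_batchFactor_le hσ₁ hBpos) hV hsum
    obtain ⟨k, hk, hle⟩ := Finset.exists_le_of_sum_le (s := Finset.range K)
      (f := fun k => ∫ ω, ‖∇ f (X k ω)‖ ∂μ)
      (g := fun _ => (∑ k ∈ Finset.range K, ∫ ω, ‖∇ f (X k ω)‖ ∂μ) / K) ⟨0, by simpa⟩ (by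
        rw [Finset.sum_const, Finset.card_range, nsmul_eq_mul, mul_div_cancel₀ _ hK0.ne'])
    refine ⟨k, Finset.mem_range.1 hk, hle.trans (hrate.trans_eq ?_)⟩
    rw [hP2, hH]
    congr 2
    · congr 3
      rw [div_div]; ring_nf
    · field_simp

/-- All the error terms decay at least as fast as `1 / P`. -/
lemma rate_le_div {c ρ P H P' K W Δ Δ' L σ₀ σ₁ s s' g g' : ℝ} (hc : 0 ≤ c) (hρ : 0 < ρ)
    (hP : 0 < P) (hH : P ≤ H) (hP' : P ≤ P') (hK : P ≤ K) (hW : 0 < W) (hL : 0 ≤ L) (hσ₁ : 0 ≤ σ₁)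
    (hΔ : Δ ≤ Δ') (hs0 : 0 ≤ s) (hs : s ≤ s') (hg0 : 0 ≤ g) (hg : g ≤ g') :
    c * (Δ / (ρ * P) + L / (ρ * P) + σ₀ / (ρ * W * P) + L / (ρ * H) + s / (ρ * P')
      + σ₁ * g / (ρ * W * K))
      ≤ c * ((Δ' + L + σ₀ / W + L + s' + σ₁ * g' / W) / ρ) / P := by
  have e : c * ((Δ' + L + σ₀ / W + L + s' + σ₁ * g' / W) / ρ) / P
      = c * (Δ' / (ρ * P) + L / (ρ * P) + σ₀ / (ρ * W * P) + L / (ρ * P) + s' / (ρ * P)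
        + σ₁ * g' / (ρ * W * P)) := by
    field_simp
  have hs' : 0 ≤ s' := hs0.trans hs
  have hg' : 0 ≤ g' := hg0.trans hg
  rw [e]
  gcongr

theorem theorem1 (α : ℝ) (hα₁ : 1 < α) (hα₂ : α ≤ 2) :
    ∃ Cα : ℝ, 0 < Cα ∧ Cα ≤ 2 ∧ ∀ d₀ : ℕ,
      -- the explicit bound; the hidden constant `c` depends on `α` and `d₀` only
      (∃ c : ℝ, 0 < c ∧
        ∀ (m n : ℕ), min m n = d₀ →
        ∀ (B : ℕ) (L σ₀ σ₁ : ℝ), 0 ≤ L → 0 ≤ σ₀ → 0 ≤ σ₁ →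
        batchThreshold α Cα d₀ σ₁ < (B : ℝ) →
        ∀ (f : Mat m n → ℝ) (fstar : ℝ) (X₀ Cinit : Mat m n),
        LSmooth f L → (∀ Y, fstar ≤ f Y) →
        0 < rhoEx α Cα d₀ σ₁ B ∧
        ∀ (K : ℕ), 2 ≤ K →
        ∀ {Ω : Type u} {mΩ : MeasurableSpace Ω} (μ : Measure Ω) [IsProbabilityMeasure μ]
          (𝓕 : Filtration ℕ mΩ) (G : ℕ → Fin B → Ω → Mat m n) (C M X : ℕ → Ω → Mat m n),
        IsMuonRun K (stepSize α K) (momentum α K) X₀ Cinit G C M X →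
        HeavyTailedNoise μ 𝓕 f α σ₀ σ₁ K G X →
        (∀ k < K, Integrable (fun ω => ∇ f (X k ω)) μ) ∧
        Integrable (fun ω => (1 - momentum α K) • M 0 ω - ∇ f (X 0 ω)) μ ∧
        ∃ k < K, ∫ ω, ‖∇ f (X k ω)‖ ∂μ ≤
          c * ((f X₀ - fstar)
                / (rhoEx α Cα d₀ σ₁ B * (K : ℝ) ^ ((α - 1) / (3 * α - 2)))
            + L / (rhoEx α Cα d₀ σ₁ B * (K : ℝ) ^ ((α - 1) / (3 * α - 2)))
            + σ₀ / (rhoEx α Cα d₀ σ₁ B * (B : ℝ) ^ ((α - 1) / α)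
                * (K : ℝ) ^ ((α - 1) / (3 * α - 2)))
            + L / (rhoEx α Cα d₀ σ₁ B * (K : ℝ) ^ ((2 * α - 1) / (3 * α - 2)))
            + (∫ ω, ‖(1 - momentum α K) • M 0 ω - ∇ f (X 0 ω)‖ ∂μ)
                / (rhoEx α Cα d₀ σ₁ B * (K : ℝ) ^ ((2 * α - 2) / (3 * α - 2)))
            + σ₁ * ‖∇ f X₀‖ / (rhoEx α Cα d₀ σ₁ B * (B : ℝ) ^ ((α - 1) / α) * (K : ℝ)))) ∧
      -- the rate, and the iteration and sample complexity, for fixed problem parameters and fixed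
      -- batch size; `Δ`, `γ`, `R` bound the initial gap, the initial gradient and the initial momentum
      (∀ (B : ℕ) (L σ₀ σ₁ Δ γ R : ℝ), 0 ≤ L → 0 ≤ σ₀ → 0 ≤ σ₁ →
        batchThreshold α Cα d₀ σ₁ < (B : ℝ) →
        ∃ Q : ℝ, 0 < Q ∧
        ∀ (m n : ℕ), min m n = d₀ →
        ∀ (f : Mat m n → ℝ) (fstar : ℝ) (X₀ Cinit : Mat m n),
        LSmooth f L → (∀ Y, fstar ≤ f Y) →
        f X₀ - fstar ≤ Δ → ‖∇ f X₀‖ ≤ γ → ‖Cinit‖ ≤ R →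
        (∀ (K : ℕ), 2 ≤ K →
          ∀ {Ω : Type u} {mΩ : MeasurableSpace Ω} (μ : Measure Ω) [IsProbabilityMeasure μ]
            (𝓕 : Filtration ℕ mΩ) (G : ℕ → Fin B → Ω → Mat m n) (C M X : ℕ → Ω → Mat m n),
          IsMuonRun K (stepSize α K) (momentum α K) X₀ Cinit G C M X →
          HeavyTailedNoise μ 𝓕 f α σ₀ σ₁ K G X →
          ∃ k < K, ∫ ω, ‖∇ f (X k ω)‖ ∂μ ≤ Q / (K : ℝ) ^ ((α - 1) / (3 * α - 2))) ∧
        (∀ ε : ℝ, 0 < ε → ε ≤ 1 →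
          ∃ K : ℕ, 2 ≤ K ∧
          (K : ℝ) ≤ Q * ε ^ (-((3 * α - 2) / (α - 1))) ∧
          ((B * K : ℕ) : ℝ) ≤ Q * ε ^ (-((3 * α - 2) / (α - 1))) ∧
          ∀ {Ω : Type u} {mΩ : MeasurableSpace Ω} (μ : Measure Ω) [IsProbabilityMeasure μ]
            (𝓕 : Filtration ℕ mΩ) (G : ℕ → Fin B → Ω → Mat m n) (C M X : ℕ → Ω → Mat m n),
          IsMuonRun K (stepSize α K) (momentum α K) X₀ Cinit G C M X →
          HeavyTailedNoise μ 𝓕 f α σ₀ σ₁ K G X →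
          ∃ k < K, ∫ ω, ‖∇ f (X k ω)‖ ∂μ ≤ ε)) := by
  refine ⟨2, by norm_num, le_rfl, fun d₀ => ⟨⟨16 * (1 + √(d₀ : ℝ)) ^ 2, by positivity, ?_⟩, ?_⟩⟩
  · rintro m n rfl B L σ₀ σ₁ hL hσ₀ hσ₁ hB f fstar X₀ Cinit hf hfb
    refine ⟨rhoEx_pos hα₁ zero_le_two hσ₁ hB, ?_⟩
    intro K hK Ω mΩ μ _ 𝓕 G C M X hrun hnoise
    obtain ⟨h1, h2, -, h3⟩ := hrun.exists_integral_norm_gradient_le hnoise hα₁ hα₂ hσ₀ hσ₁ hf hL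
      hfb hB hK
    exact ⟨h1, h2, h3⟩
  · intro B L σ₀ σ₁ Δ γ R hL hσ₀ hσ₁ hB
    have hBpos := batch_pos_of_threshold_lt zero_le_two hσ₁ hB
    have hB' : (0 : ℝ) < B := by exact_mod_cast hBpos
    have hρ := rhoEx_pos hα₁ zero_le_two hσ₁ hB
    have hden : 0 < 3 * α - 2 := by linarith
    have hα' : 0 < α - 1 := by linarith
    set ρ := rhoEx α 2 d₀ σ₁ B with hρdef
    set W : ℝ := (B : ℝ) ^ ((α - 1) / α) with hW
    have hW0 : 0 < W := by positivity
    set s' : ℝ := |R| + 2 * (σ₀ / W + σ₁ * |γ| / W) + |γ| with hs'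
    set Q₁ : ℝ := 16 * (1 + √(d₀ : ℝ)) ^ 2 *
      ((|Δ| + L + σ₀ / W + L + s' + σ₁ * |γ| / W) / ρ) with hQ₁
    have hQ₁0 : 0 ≤ Q₁ := by positivity
    set e : ℝ := (3 * α - 2) / (α - 1) with he
    have he0 : 0 < e := by positivity
    have hB1 : (1 : ℝ) ≤ B := by exact_mod_cast hBpos
    have hrate : ∀ (m n : ℕ), min m n = d₀ → ∀ (f : Mat m n → ℝ) (fstar : ℝ) (X₀ Cinit : Mat m n),
        LSmooth f L → (∀ Y, fstar ≤ f Y) → f X₀ - fstar ≤ Δ → ‖∇ f X₀‖ ≤ γ → ‖Cinit‖ ≤ R →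
        ∀ (K : ℕ), 2 ≤ K → ∀ {Ω : Type u} {mΩ : MeasurableSpace Ω} (μ : Measure Ω)
          [IsProbabilityMeasure μ] (𝓕 : Filtration ℕ mΩ) (G : ℕ → Fin B → Ω → Mat m n)
          (C M X : ℕ → Ω → Mat m n),
        IsMuonRun K (stepSize α K) (momentum α K) X₀ Cinit G C M X →
        HeavyTailedNoise μ 𝓕 f α σ₀ σ₁ K G X →
        ∃ k < K, ∫ ω, ‖∇ f (X k ω)‖ ∂μ ≤ Q₁ / (K : ℝ) ^ ((α - 1) / (3 * α - 2)) := by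
      rintro m n rfl f fstar X₀ Cinit hf hfb hΔ hγ hR K hK Ω mΩ μ _ 𝓕 G C M X hrun hnoise
      obtain ⟨-, -, h2, k, hk, h3⟩ := hrun.exists_integral_norm_gradient_le hnoise hα₁ hα₂ hσ₀ hσ₁
        hf hL hfb hB hK
      refine ⟨k, hk, h3.trans ?_⟩
      have hK1 : (1 : ℝ) ≤ K := by exact_mod_cast (by omega : 1 ≤ K)
      have hγ' : ‖∇ f X₀‖ ≤ |γ| := hγ.trans (le_abs_self γ)
      refine rate_le_div (by positivity) hρ (by positivity) ?_ ?_ ?_ hW0 hL hσ₁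
        (hΔ.trans (le_abs_self Δ)) (integral_nonneg fun _ => norm_nonneg _) (h2.trans ?_)
        (norm_nonneg _) hγ'
      · exact Real.rpow_le_rpow_of_exponent_le hK1
          (div_le_div_of_nonneg_right (by linarith) hden.le)
      · exact Real.rpow_le_rpow_of_exponent_le hK1
          (div_le_div_of_nonneg_right (by linarith) hden.le)
      · exact Real.rpow_le_self_of_one_le hK1 ((div_le_one hden).2 (by linarith))
      · have hR' : ‖Cinit‖ ≤ |R| := hR.trans (le_abs_self R)
        rw [hs']
        gcongr
    -- The second entry bounds `B K / ε ^ (-e)` for the horizon `K` chosen below.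
    refine ⟨max Q₁ (B * (Q₁ ^ e + 3)), lt_max_of_lt_right (by positivity), ?_⟩
    intro m n hmn f fstar X₀ Cinit hf hfb hΔ hγ hR
    refine ⟨fun K hK Ω mΩ μ _ 𝓕 G C M X hrun hnoise => ?_, fun ε hε0 hε1 => ?_⟩
    · obtain ⟨k, hk, h⟩ := hrate m n hmn f fstar X₀ Cinit hf hfb hΔ hγ hR K hK μ 𝓕 G C M X hrun
        hnoise
      exact ⟨k, hk, h.trans (by gcongr; exact le_max_left _ _)⟩
    · -- The least horizon, at least `2`, for which the rate is at most `ε`.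
      set K : ℕ := max 2 ⌈(Q₁ / ε) ^ e⌉₊ with hKdef
      have hK2 : 2 ≤ K := le_max_left _ _
      have hK0 : (0 : ℝ) < K := by exact_mod_cast (by omega : 0 < K)
      have hKge : (Q₁ / ε) ^ e ≤ K := (Nat.le_ceil _).trans (by exact_mod_cast le_max_right _ _)
      have hε : 1 ≤ ε ^ (-e) := Real.one_le_rpow_of_pos_of_le_one_of_nonpos hε0 hε1 (by linarith)
      have hpow : (Q₁ / ε) ^ e = Q₁ ^ e * ε ^ (-e) := by
        rw [Real.div_rpow hQ₁0 hε0.le, Real.rpow_neg hε0.le, div_eq_mul_inv]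
      have hKle : (K : ℝ) ≤ (Q₁ ^ e + 3) * ε ^ (-e) := by
        have h1 : (K : ℝ) ≤ 2 + ⌈(Q₁ / ε) ^ e⌉₊ := by
          exact_mod_cast max_le (Nat.le_add_right _ _) (Nat.le_add_left _ _)
        have h2 := (Nat.ceil_lt_add_one (Real.rpow_nonneg (div_nonneg hQ₁0 hε0.le) e)).le
        rw [hpow] at h2
        rw [hpow] at h1
        linarith
      have hBK : (B : ℝ) * K ≤ max Q₁ (B * (Q₁ ^ e + 3)) * ε ^ (-e) := by
        refine (mul_le_mul_of_nonneg_left hKle hB'.le).trans ?_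
        rw [← mul_assoc]
        gcongr
        exact le_max_right _ _
      refine ⟨K, hK2, (le_mul_of_one_le_left hK0.le hB1).trans hBK, by exact_mod_cast hBK, ?_⟩
      intro Ω mΩ μ _ 𝓕 G C M X hrun hnoise
      obtain ⟨k, hk, h⟩ := hrate m n hmn f fstar X₀ Cinit hf hfb hΔ hγ hR K hK2 μ 𝓕 G C M X hrun
        hnoise
      refine ⟨k, hk, h.trans ?_⟩
      rw [div_le_iff₀ (by positivity), mul_comm, ← div_le_iff₀ hε0]
      have h1 := Real.rpow_le_rpow (by positivity) hKge
        (show 0 ≤ (α - 1) / (3 * α - 2) by positivity)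
      rwa [← Real.rpow_mul (by positivity), he, div_mul_div_cancel₀ hα'.ne', div_self hden.ne',
        Real.rpow_one] at h1
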